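/- **Setting.** A cloud network is a finite directed graph $(\mathcal V,\mathcal E)$ with processing capacities $C_i\ge 0$ and costs $e_i\ge 0$ at the nodes, and transmission capacities $C_{ij}\ge 0$ and costs $e_{ij}\ge 0$ on the links. There are finitely many services $\phi$. Service $\phi$ is a chain of $M_\phi-1$ functions ($M_\phi\ge1$); its $m$-th function turns stage $m$ into stage $m+1$ data, with scaling factor $\xi_\phi^{(m)}\ge0$ and workload $r_\phi^{(m)}>0$ per unit of input. Write $c=(\phi,m,D)$ with $D\subset\mathcal V$ one of the destination sets of $\phi$, and call $c$ final if $m=M_\phi$. A packet of commodity $(c,q)$ has the nonempty set $q\subset D$ of current destinations (its duplication status). Vectors and formulas below concern nonempty statuses only; terms with an empty status are zero. Packets in a final stage with $i\in q$ that reach node $i$ are consumed there and continue with status $q\setminus\{i\}$. Let $\lambda=\{\lambda_i^{(c,q)}\}\ge 0$ be the vector of mean exogenous arrival rates, and $\overline{z(t)}=\lim_{T\to\infty}\frac1T\sum_{t=1}^T z(t)$. **Balance.** For rates $\mathrm{in}(q),\mathrm{out}(q)$ into and out of the queues of $(c,q)$ at node $i$, "balance at $(i,c)$" means: if $c$ is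 not final or $i\notin D$, then $\mathrm{in}(q)\le\mathrm{out}(q)$ for all $q$; if $c$ is final and $i\in D$, then $\mathrm{in}(q)+\mathrm{in}(q\cup\{i\})\le \mathrm{out}(q)$ for all $q\not\ni i$ (and no condition for $q\ni i$). **Policies.** A policy consists of random decisions for all slots $t$, on some probability space: integrable amounts $f_{i,\mathrm{pr}}^{(c,q)}(t)\ge0$ (processed at $i$; zero for final $c$) and $f_{ij}^{(c,q)}(t)\ge0$ (transmitted), and amounts $d_i^{(c,q;s,r)}(t)\ge0$ of packets of commodity $(c,q)$ that node $i$ duplicates into two copies of statuses $s,r\subset D$ that cover $q$, i.e. $q\subset s\cup r$. It is admissible under $\lambda$ if, almost surely in every slot, $\sum_{(c,q)} r_\phi^{(m)} f_{i,\mathrm{pr}}^{(c,q)}(t)\le C_i$ and $\sum_{(c,q)} f_{ij}^{(c,q)}(t)\le C_{ij}$, and the following hold. With $f_{\mathrm{pr},i}^{(\phi,1,D,q)}=0$ and $f_{\mathrm{pr},i}^{(\phi,m+1,D,q)}=\xi_\phi^{(m)}f_{i,\mathrm{pr}}^{(\phi,m,D,q)}$, the limits $$f_{\to i}^{(c,q)}=\overline{\mathbb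 E\{f_{\mathrm{pr},i}^{(c,q)}(t)+\textstyle\sum_{j:(j,i)\in\mathcal E} f_{ji}^{(c,q)}(t)\}},\qquad f_{i\to}^{(c,q)}=\overline{\mathbb E\{f_{i,\mathrm{pr}}^{(c,q)}(t)+\textstyle\sum_{j:(i,j)\in\mathcal E} f_{ij}^{(c,q)}(t)\}}$$ exist, as do the long-term averages $d_{\to i}^{(c,q)}$, $d_{i\to}^{(c,q)}$ of the expected amounts of copies of status $q$ created by duplication, and of packets of status $q$ that are duplicated, at node $i$; for all $i,c$ and all $k\in D$, except when $c$ is final and $k=i$, $$\sum_{q\ni k}\big[f_{\to i}^{(c,q)}+\lambda_i^{(c,q)}\big]\le\sum_{q\ni k}f_{i\to}^{(c,q)};$$ and for all $i,c$ balance holds with $\mathrm{in}(q)=f_{\to i}^{(c,q)}+\lambda_i^{(c,q)}+d_{\to i}^{(c,q)}$ and $\mathrm{out}(q)=f_{i\to}^{(c,q)}+d_{i\to}^{(c,q)}$. The multicast capacity region $\Lambda$ is the set of all $\lambda$ under which some policy is admissible. The cost in slot $t$ is $h(t)=\sum_i e_i\sum_{(c,q)} r_\phi^{(m)} f_{i,\mathrm{pr}}^{(c,q)}(t)+\sum_{(i,j)}e_{ij}\sum_{(c,q)}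 f_{ij}^{(c,q)}(t)$, and $h^\star(\lambda)$ is the infimum of $\overline{\mathbb E\{h(t)\}}$ over all policies admissible under $\lambda$ for which this limit exists. **Theorem 1 (capacity region characterization).** Let $\lambda\ge0$. Then $\lambda\in\Lambda$ if and only if there are flow variables $f_{i,\mathrm{pr}}^{(c,q,s)}, f_{ij}^{(c,q,s)}\ge0$ ($\emptyset\ne s\subset q\subset D$; $f_{i,\mathrm{pr}}$ only for non-final $c$) and, on the same indices, values $\beta_i^{(c,q,s)},\beta_{ij}^{(c,q,s)}\ge0$ with $\sum_{(c,q,s)}\beta_i^{(c,q,s)}\le1$ for every node and $\sum_{(c,q,s)}\beta_{ij}^{(c,q,s)}\le1$ for every link, such that 1. for all $i,c$, balance holds with $$\mathrm{in}(q)=\lambda_i^{(c,q)}+\sum_{s\subset D\setminus q}\Big[f_{\mathrm{pr},i}^{(c,q\cup s,q)}+\sum_{j:(j,i)\in\mathcal E}f_{ji}^{(c,q\cup s,q)}+f_{i,\mathrm{pr}}^{(c,q\cup s,s)}+\sum_{j:(i,j)\in\mathcal E}f_{ij}^{(c,q\cup s,s)}\Big],$$ $$\mathrm{out}(q)=\sum_{s\subset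 q}\Big[f_{i,\mathrm{pr}}^{(c,q,s)}+\sum_{j:(i,j)\in\mathcal E}f_{ij}^{(c,q,s)}\Big];$$ 2. $f_{\mathrm{pr},i}^{(\phi,m+1,D,q,s)}=\xi_\phi^{(m)}f_{i,\mathrm{pr}}^{(\phi,m,D,q,s)}$ and $f_{\mathrm{pr},i}^{(\phi,1,D,q,s)}=0$; 3. $f_{i,\mathrm{pr}}^{(c,q,s)}\le (C_i/r_\phi^{(m)})\,\beta_i^{(c,q,s)}$ for non-final $c$, and $f_{ij}^{(c,q,s)}\le\beta_{ij}^{(c,q,s)}C_{ij}$. Moreover, if $\lambda\in\Lambda$, then $f$ and $\beta$ with these properties can be chosen such that the stationary randomized policy specified by $\beta$ is admissible under $\lambda$ and has $\overline{\mathbb E\{h(t)\}}=h^\star(\lambda)$. In this policy every interface (processing unit of a node, or link), independently of the others and in every slot, chooses $(c,q,s)$ with probability $\beta^{(c,q,s)}$, or stays idle with the remaining probability; it then uses all its resource ($C_i/r_\phi^{(m)}$ or $C_{ij}$ packets) to operate copies of status $s$ taken from packets of commodity $(c,q)$, and the copies of status $q\setminus s$ are kept at the node. -/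

import Mathlib

open MeasureTheory Filter Topology

universe u v

/-- A cloud network together with the multicast services it offers. A service `φ` is a chain of
`numFun φ` functions, so its data-streams have the `numFun φ + 1` stages `0, …, numFun φ`; the
function of index `m` turns stage `m` into stage `m + 1`. -/
structure CloudNetwork (V : Type u) (Φ : Type v) where
  /-- the directed links -/
  links : Finset (V × V)
  /-- processing capacity of a node -/
  nodeCap : V → ℝ
  /-- cost of one unit of processing resource at a node -/
  nodeCost : V → ℝ
  /-- transmission capacity of a link -/
  linkCap : V × V → ℝ
  /-- cost of transmitting one unit of data on a link -/
  linkCost : V × V → ℝ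
  /-- number of functions of a service -/
  numFun : Φ → ℕ
  /-- output data size per unit of input data -/
  scaling : (φ : Φ) → Fin (numFun φ) → ℝ
  /-- computing resource needed per unit of input data -/
  workload : (φ : Φ) → Fin (numFun φ) → ℝ
  /-- the destination sets by which a service may be consumed -/
  destSets : Φ → Finset (Finset V)
  nodeCap_nonneg : ∀ i, 0 ≤ nodeCap i
  nodeCost_nonneg : ∀ i, 0 ≤ nodeCost i
  linkCap_nonneg : ∀ e ∈ links, 0 ≤ linkCap e
  linkCost_nonneg : ∀ e ∈ links, 0 ≤ linkCost e
  scaling_nonneg : ∀ φ m, 0 ≤ scaling φ m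
  workload_pos : ∀ φ m, 0 < workload φ m

/-- The long-term average of `z` exists and equals `l`. -/
def HasLongTermAvg (z : ℕ → ℝ) (l : ℝ) : Prop :=
  Tendsto (fun T : ℕ => (T : ℝ)⁻¹ * ∑ t ∈ Finset.Icc 1 T, z t) atTop (𝓝 l)

namespace CloudNetwork

variable {V : Type u} {Φ : Type v} (N : CloudNetwork V Φ)

/-- The links, as a type. -/
abbrev Link : Type u := {e : V × V // e ∈ N.links}

/-- The interfaces on which packets are operated: the processing unit of node `i` is `Sum.inl i`,
the link `e` is `Sum.inr e`. -/
abbrev Interface : Type u := V ⊕ N.Link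

/-- The triples `c = (φ, m, D)` of service, stage and destination set. A duplication status for `c`
is written as the set `q ⊆ D` of the current destinations; the empty status is disregarded. -/
abbrev Chain : Type (max u v) :=
  Σ φ : Φ, Fin (N.numFun φ + 1) × {D : Finset V // D ∈ N.destSets φ}

variable {N}

/-- The destination set of `c`. -/
def Chain.dest (c : N.Chain) : Finset V := c.2.2.1

/-- `c` is at the last stage of its service: it is to be delivered, no function is left. -/
def Chain.IsFinal (c : N.Chain) : Prop := c.2.1 = Fin.last (N.numFun c.1)

/-- The workload of the function that processes `c` (`0` at the last stage, where processing is
not possible). -/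
def Chain.load (c : N.Chain) : ℝ :=
  if h : c.2.1.val < N.numFun c.1 then N.workload c.1 ⟨c.2.1.val, h⟩ else 0

/-- The flow of `c = (φ, m, D)` that comes out of a processing unit, when `g c'` is the flow of `c'`
that enters it: `0` at the first stage, and `ξ_φ^{(m)}` times the flow of `(φ, m, D)` for
`(φ, m + 1, D)`. -/
def processed (g : N.Chain → ℝ) (c : N.Chain) : ℝ :=
  Fin.cases (motive := fun _ => ℝ) 0
    (fun m => N.scaling c.1 m * g ⟨c.1, m.castSucc, c.2.2⟩) c.2.1

variable (N) in
/-- Arrival rates `λ_i^{(c,q)}`. -/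
abbrev ArrivalVector : Type (max u v) := V → N.Chain → Finset V → ℝ

/-- Processing is only possible before the last stage; every link carries all stages. -/
def CanOperate : N.Interface → N.Chain → Prop
  | Sum.inl _, c => ¬ c.IsFinal
  | Sum.inr _, _ => True

section Rates

variable [DecidableEq V]

/-- The balance conditions of the queues of `(c, q)`, `∅ ≠ q ⊆ D`, at node `i`, when `input q` and
`output q` are the total rates into and out of them: `input q ≤ output q`. If `c` is at its last
stage and `i ∈ D`, a packet with `i ∈ q` is consumed at `i` and goes on as a packet of status
`q \ {i}`, so that queues with `i ∈ q` are always empty, while those with `i ∉ q` have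
the additional input `input (q ∪ {i})`. -/
def QueueBalance (i : V) (c : N.Chain) (input output : Finset V → ℝ) : Prop :=
  ∀ q : Finset V, q.Nonempty → q ⊆ c.dest →
    (¬ (c.IsFinal ∧ i ∈ c.dest) → input q ≤ output q) ∧
    (c.IsFinal ∧ i ∈ c.dest → i ∉ q → input q + input (insert i q) ≤ output q)

end Rates

/-! ### General policies -/

section General

variable [DecidableEq V]

/-- Amount of `(c, q)` that node `i` gets from its processing unit and its incoming links, when
`f ι c q` is the amount of `(c, q)` operated on the interface `ι`. -/
def netIn (f : N.Interface → N.Chain → Finset V → ℝ) (i : V) (c : N.Chain) (q : Finset V) : ℝ :=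
  processed (fun c' => f (Sum.inl i) c' q) c + ∑ e : N.Link with e.1.2 = i, f (Sum.inr e) c q

/-- Amount of `(c, q)` that node `i` hands to its processing unit and its outgoing links. -/
def netOut (f : N.Interface → N.Chain → Finset V → ℝ) (i : V) (c : N.Chain) (q : Finset V) : ℝ :=
  f (Sum.inl i) c q + ∑ e : N.Link with e.1.1 = i, f (Sum.inr e) c q

/-- Amount of copies of status `q` created by duplication, when `d p s r` is the amount of packets
of status `p` that are duplicated into copies of status `s` and `r`. -/
def copiesIn [Fintype V] (d : Finset V → Finset V → Finset V → ℝ) (q : Finset V) : ℝ :=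
  (∑ p : Finset V, ∑ r : Finset V, d p q r) + ∑ p : Finset V, ∑ s : Finset V, d p s q

/-- Amount of packets of status `q` that are replaced by two copies. -/
def copiesOut [Fintype V] (d : Finset V → Finset V → Finset V → ℝ) (q : Finset V) : ℝ :=
  ∑ s : Finset V, ∑ r : Finset V, d q s r

variable [Fintype V] [Fintype Φ]

/-- Resource used on an interface: computing resource on a node, amount of data on a link. -/
def usage (f : N.Interface → N.Chain → Finset V → ℝ) : N.Interface → ℝ
  | Sum.inl i => ∑ c : N.Chain, ∑ q : Finset V, c.load * f (Sum.inl i) c q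
  | Sum.inr e => ∑ c : N.Chain, ∑ q : Finset V, f (Sum.inr e) c q

/-- Instantaneous overall resource cost. -/
def cost (f : N.Interface → N.Chain → Finset V → ℝ) : ℝ :=
  (∑ i : V, N.nodeCost i * usage f (Sum.inl i)) +
    ∑ e : N.Link, N.linkCost e.1 * usage f (Sum.inr e)

end General

variable (N) in
/-- A (randomized) processing, routing and duplication policy: in every slot `t` the random amount
`op t ω ι c q` of packets of commodity `(c, q)` operated on each interface, and the random amount
`dup t ω i c q s r` of packets of commodity `(c, q)` which node `i` duplicates into copies of status
`s` and `r`. -/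
structure Policy where
  Ω : Type (max u v)
  [mΩ : MeasurableSpace Ω]
  P : Measure Ω
  [isProb : IsProbabilityMeasure P]
  op : ℕ → Ω → N.Interface → N.Chain → Finset V → ℝ
  dup : ℕ → Ω → V → N.Chain → Finset V → Finset V → Finset V → ℝ

attribute [instance] Policy.mΩ Policy.isProb

section Region

variable [DecidableEq V] [Fintype V] [Fintype Φ]

/-- The policy `π` is admissible under the arrival vector `lam`. -/
structure Policy.IsAdmissible (π : N.Policy) (lam : N.ArrivalVector) : Prop where
  op_integrable : ∀ t ι c q, Integrable (fun ω => π.op t ω ι c q) π.P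
  dup_integrable : ∀ t i c q s r, Integrable (fun ω => π.dup t ω i c q s r) π.P
  /-- non-negativity -/
  op_nonneg : ∀ t, ∀ᵐ ω ∂π.P, ∀ ι c q, 0 ≤ π.op t ω ι c q
  dup_nonneg : ∀ t, ∀ᵐ ω ∂π.P, ∀ i c q s r, 0 ≤ π.dup t ω i c q s r
  /-- only existing commodities are operated, and only existing functions are run -/
  op_support : ∀ t, ∀ᵐ ω ∂π.P, ∀ ι c q, π.op t ω ι c q ≠ 0 →
    CanOperate ι c ∧ q.Nonempty ∧ q ⊆ c.dest
  /-- a duplication makes two copies that cover the destinations of the original packet -/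
  dup_coverage : ∀ t, ∀ᵐ ω ∂π.P, ∀ i c q s r, π.dup t ω i c q s r ≠ 0 →
    q.Nonempty ∧ s.Nonempty ∧ r.Nonempty ∧ q ⊆ c.dest ∧ s ⊆ c.dest ∧ r ⊆ c.dest ∧ q ⊆ s ∪ r
  /-- capacity constraints -/
  node_capacity : ∀ t, ∀ᵐ ω ∂π.P, ∀ i, usage (π.op t ω) (Sum.inl i) ≤ N.nodeCap i
  link_capacity : ∀ t, ∀ᵐ ω ∂π.P, ∀ e, usage (π.op t ω) (Sum.inr e) ≤ N.linkCap e.1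
  /-- flow conservation and duplication, for the long-term average flows -/
  conservation : ∃ fIn fOut dIn dOut : V → N.Chain → Finset V → ℝ,
    (∀ i c q, HasLongTermAvg (fun t => ∫ ω, netIn (π.op t ω) i c q ∂π.P) (fIn i c q)) ∧
    (∀ i c q, HasLongTermAvg (fun t => ∫ ω, netOut (π.op t ω) i c q ∂π.P) (fOut i c q)) ∧
    (∀ i c q, HasLongTermAvg (fun t => ∫ ω, copiesIn (π.dup t ω i c) q ∂π.P) (dIn i c q)) ∧
    (∀ i c q, HasLongTermAvg (fun t => ∫ ω, copiesOut (π.dup t ω i c) q ∂π.P) (dOut i c q)) ∧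
    -- the generalized flow conservation and duplication law, for every destination `k`
    (∀ i (c : N.Chain), ∀ k ∈ c.dest, ¬ (c.IsFinal ∧ i = k) →
      ∑ q ∈ c.dest.powerset with k ∈ q, (fIn i c q + lam i c q) ≤
        ∑ q ∈ c.dest.powerset with k ∈ q, fOut i c q) ∧
    -- every packet that enters a node is operated or duplicated
    (∀ i c, QueueBalance i c (fun q => fIn i c q + lam i c q + dIn i c q)
      (fun q => fOut i c q + dOut i c q))

variable (N) in
/-- The multicast capacity region. -/
def capacityRegion : Set N.ArrivalVector :=
  {lam | ∃ π : N.Policy, π.IsAdmissible lam}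

/-- The policy `π` has long-term average expected cost `κ`. -/
def Policy.HasAvgCost (π : N.Policy) (κ : ℝ) : Prop :=
  HasLongTermAvg (fun t => ∫ ω, cost (π.op t ω) ∂π.P) κ

variable (N) in
/-- The optimal cost over all policies that are admissible under `lam`. -/
noncomputable def optimalCost (lam : N.ArrivalVector) : ℝ :=
  sInf {κ | ∃ π : N.Policy, π.IsAdmissible lam ∧ π.HasAvgCost κ}

end Region

/-! ### Flow variables, selection probabilities and stationary randomized policies -/

/-- `(c, q, s)` can be chosen on the interface `ι`: packets of commodity `(c, q)` are taken, copies
of status `s` are operated, and, unless `s = q`, copies of status `q \ s` are reloaded. -/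
def Selectable (ι : N.Interface) (c : N.Chain) (q s : Finset V) : Prop :=
  CanOperate ι c ∧ s.Nonempty ∧ s ⊆ q ∧ q ⊆ c.dest

/-- The amount of packets that the interface operates if it spends all its resource on `c`: `C_i/r`
on a node, `C_{ij}` on a link. -/
noncomputable def fullAmount : N.Interface → N.Chain → ℝ
  | Sum.inl i, c => N.nodeCap i / c.load
  | Sum.inr e, _ => N.linkCap e.1

variable (N) in
/-- Variables `f_{i,pr}^{(c,q,s)}` (on `Sum.inl i`) and `f_{ij}^{(c,q,s)}` (on `Sum.inr (i,j)`). -/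
abbrev FlowVector : Type (max u v) := N.Interface → N.Chain → Finset V → Finset V → ℝ

variable (N) in
/-- Probabilities `β_i^{(c,q,s)}`, `β_{ij}^{(c,q,s)}` with which the interfaces choose `(c, q, s)`;
an interface is idle with the remaining probability. -/
structure SelectionProb [Fintype V] [Fintype Φ] where
  val : N.Interface → N.Chain → Finset V → Finset V → ℝ
  nonneg : ∀ ι c q s, 0 ≤ val ι c q s
  support : ∀ ι c q s, val ι c q s ≠ 0 → Selectable ι c q s
  sum_le_one : ∀ ι, ∑ a : N.Chain × Finset V × Finset V, val ι a.1 a.2.1 a.2.2 ≤ 1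

section Efficient

variable [DecidableEq V]

/-- Rate into the queue of `(c, q)` at node `i`: operated copies of status `q` from the processing
unit and the incoming links, and the copies of status `q` that are reloaded at `i`. -/
def rateIn (f : N.FlowVector) (i : V) (c : N.Chain) (q : Finset V) : ℝ :=
  ∑ s ∈ (c.dest \ q).powerset,
    (processed (fun c' => f (Sum.inl i) c' (q ∪ s) q) c
      + (∑ e : N.Link with e.1.2 = i, f (Sum.inr e) c (q ∪ s) q)
      + f (Sum.inl i) c (q ∪ s) s
      + ∑ e : N.Link with e.1.1 = i, f (Sum.inr e) c (q ∪ s) s)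

/-- Rate out of the queue of `(c, q)` at node `i`. -/
def rateOut (f : N.FlowVector) (i : V) (c : N.Chain) (q : Finset V) : ℝ :=
  ∑ s ∈ q.powerset, (f (Sum.inl i) c q s + ∑ e : N.Link with e.1.1 = i, f (Sum.inr e) c q s)

/-- The conditions on flow variables `f` and probabilities `β` for the arrival vector `lam`. -/
structure IsFeasible [Fintype V] [Fintype Φ] (lam : N.ArrivalVector) (f : N.FlowVector)
    (β : N.SelectionProb) : Prop where
  nonneg : ∀ ι c q s, 0 ≤ f ι c q s
  support : ∀ ι c q s, f ι c q s ≠ 0 → Selectable ι c q s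
  conservation : ∀ i c, QueueBalance i c (fun q => rateIn f i c q + lam i c q)
    (fun q => rateOut f i c q)
  node_le : ∀ i (c : N.Chain), ¬ c.IsFinal → ∀ q s,
    f (Sum.inl i) c q s ≤ (N.nodeCap i / c.load) * β.val (Sum.inl i) c q s
  link_le : ∀ e c q s, f (Sum.inr e) c q s ≤ β.val (Sum.inr e) c q s * N.linkCap e.1

end Efficient

variable (N) in
/-- The choice of an interface in a slot: `none` (idle) or `some (c, q, s)`. -/
def Choice : Type (max u v) := Option (N.Chain × Finset V × Finset V)

instance : MeasurableSpace N.Choice := ⊤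

section Star

variable [Fintype V] [Fintype Φ]

/-- The law of the choice of the interface `ι`. -/
noncomputable def SelectionProb.law (β : N.SelectionProb) (ι : N.Interface) : PMF N.Choice :=
  PMF.ofFintype (α := Option (N.Chain × Finset V × Finset V))
    (fun o => o.elim
      (ENNReal.ofReal (1 - ∑ a : N.Chain × Finset V × Finset V, β.val ι a.1 a.2.1 a.2.2))
      (fun a => ENNReal.ofReal (β.val ι a.1 a.2.1 a.2.2)))
    (by
      rw [Fintype.sum_option]
      simp only [Option.elim]
      rw [← ENNReal.ofReal_sum_of_nonneg (fun a _ => β.nonneg ι a.1 a.2.1 a.2.2),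
        ← ENNReal.ofReal_add (sub_nonneg.2 (β.sum_le_one ι))
          (Finset.sum_nonneg fun a _ => β.nonneg ι a.1 a.2.1 a.2.2)]
      simp)

variable (N) in
/-- Sample space of the choices of all interfaces in all slots. -/
abbrev ChoiceSpace : Type (max u v) := ℕ × N.Interface → N.Choice

/-- The choices are independent over slots and interfaces, with the laws given by `β`. -/
noncomputable def SelectionProb.measure (β : N.SelectionProb) : Measure N.ChoiceSpace :=
  Measure.infinitePi fun p : ℕ × N.Interface => (β.law p.2).toMeasure

instance (β : N.SelectionProb) : IsProbabilityMeasure β.measure := by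
  unfold SelectionProb.measure
  infer_instance

/-- The decisions `x(t)` for given choices: all the resource of each interface is used to operate
the chosen copies. -/
noncomputable def choiceDecision (t : ℕ) (ω : N.ChoiceSpace) : N.FlowVector :=
  fun ι c q s => Set.indicator {o : N.Choice | o = some (c, q, s)} (fun _ => fullAmount ι c)
    (ω (t, ι))

variable [DecidableEq V]

/-- The stationary randomized policy specified by `β`. The packets taken from `(c, q)` to operate
copies of status `s ≠ q` are duplicated into copies of status `s` and `q \ s`. -/
noncomputable def SelectionProb.stationaryPolicy (β : N.SelectionProb) : N.Policy where
  Ω := N.ChoiceSpace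
  P := β.measure
  op := fun t ω ι c s => ∑ q : Finset V, choiceDecision t ω ι c q s
  dup := fun t ω i c q s r =>
    if s ≠ q ∧ r = q \ s then
      choiceDecision t ω (Sum.inl i) c q s
        + ∑ e : N.Link with e.1.1 = i, choiceDecision t ω (Sum.inr e) c q s
    else 0

end Star

end CloudNetwork

/-!
The theorem says that a time average over an arbitrary policy can be replaced by constant flow
variables, and that these can be realized by independent random choices.

*From flow variables to policies.* If `f` satisfies the balance and capacity conditions, let each
interface choose `(c, q, s)` with probability `f / (C / r)`. Since the interface then uses all its
resource, it carries `f` on average (`IsEfficientFlow.fullAmount_mul_selection`), and the balance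
conditions for `f` turn into those for the policy (`IsEfficientFlow.isAdmissible`). Only operations
on packets that have already been consumed have to be dropped from `f` first
(`IsFeasible.exists_isEfficientFlow`).

*From policies to flow variables.* The averages of an admissible policy have an accumulation point,
which is a static flow with the same balance (`Policy.IsAdmissible.exists_isNominalFlow`). Such a
flow may still duplicate wastefully: copies may overlap, and may have more destinations than the
original. It is emulated by packets that serve each destination once. A packet of the
emulation carries an assignment of its remaining destinations to copies of the given flow. In each
step one of these copies, of status `n`, leaves its queue in one of the ways in which the given
flow leaves this queue, with probabilities proportional to the rates. If the copy is
operated, the set `s` of the destinations that it serves is operated from the status `q` of the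
packet, and `q \ s` is reloaded; if it is duplicated, its destinations are distributed over the two
copies, which is possible because these cover `n`. This is a branching process with finitely
many types. By the balance conditions the rates out of the queues of the given flow are a
supersolution of the equations for the numbers of copies that are used. Hence the
expected numbers of visits are finite and each interface is used no more than by the given flow
(`exists_occupation`, `IsNominalFlow.exists_visits`), and the visits yield flow variables
that satisfy the balance conditions (`IsNominalFlow.emulated_balance`).

*Optimal cost.* The emulation costs no more than the policy, so the optimal cost is the infimum of
the cost over the flow variables, which form a compact set (`exists_isMinOn_cost`).
-/

namespace CloudNetwork

open scoped Classical

/-! ### Interfaces -/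

section Interfaces

variable {V : Type u} {Φ : Type v} {N : CloudNetwork V Φ}

/-- The node from whose queues the interface takes packets. -/
def source : N.Interface → V
  | Sum.inl i => i
  | Sum.inr e => e.1.1

/-- The resource that one unit of `c` needs on the interface. -/
def resource : N.Interface → N.Chain → ℝ
  | Sum.inl _, c => c.load
  | Sum.inr _, _ => 1

/-- The total resource of the interface. -/
def capacity : N.Interface → ℝ
  | Sum.inl i => N.nodeCap i
  | Sum.inr e => N.linkCap e.1

/-- The cost of one unit of resource of the interface. -/
def price : N.Interface → ℝ
  | Sum.inl i => N.nodeCost i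
  | Sum.inr e => N.linkCost e.1

/-- The flow that consists of one unit of `c'`. -/
noncomputable def unitFlow (c' : N.Chain) : N.Chain → ℝ := Set.indicator {c'} 1

/-- The amount of `c` that arrives at node `j` for each unit of `c'` operated on the interface. -/
noncomputable def deliver [DecidableEq V] (ι : N.Interface) (c' : N.Chain) (j : V)
    (c : N.Chain) : ℝ :=
  match ι with
  | Sum.inl i => if i = j then processed (unitFlow c') c else 0
  | Sum.inr e => if e.1.2 = j then unitFlow c' c else 0

theorem capacity_nonneg (ι : N.Interface) : 0 ≤ capacity ι := by
  rcases ι with i | e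
  · exact N.nodeCap_nonneg i
  · exact N.linkCap_nonneg _ e.2

theorem price_nonneg (ι : N.Interface) : 0 ≤ price ι := by
  rcases ι with i | e
  · exact N.nodeCost_nonneg i
  · exact N.linkCost_nonneg _ e.2

theorem resource_nonneg (ι : N.Interface) (c : N.Chain) : 0 ≤ resource ι c := by
  rcases ι with i | e
  · simp only [resource, Chain.load]
    split_ifs
    exacts [(N.workload_pos _ _).le, le_rfl]
  · exact zero_le_one

theorem resource_pos {ι : N.Interface} {c : N.Chain} (h : CanOperate ι c) : 0 < resource ι c := by
  rcases ι with i | e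
  · have hc : c.2.1.val < N.numFun c.1 := by
      refine lt_of_le_of_ne (Nat.lt_succ_iff.1 c.2.1.2) fun h' => h (Fin.ext ?_)
      simpa using h'
    simp only [resource, Chain.load, dif_pos hc]
    exact N.workload_pos _ _
  · exact zero_lt_one

theorem fullAmount_eq (ι : N.Interface) (c : N.Chain) :
    fullAmount ι c = capacity ι / resource ι c := by
  rcases ι with i | e
  · rfl
  · simp [fullAmount, capacity, resource]

theorem fullAmount_nonneg (ι : N.Interface) (c : N.Chain) : 0 ≤ fullAmount ι c := by
  rw [fullAmount_eq]
  exact div_nonneg (capacity_nonneg ι) (resource_nonneg ι c)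

theorem unitFlow_nonneg (c' c : N.Chain) : 0 ≤ unitFlow c' c :=
  Set.indicator_nonneg (fun _ _ => zero_le_one) c

theorem eq_of_unitFlow_ne_zero {c' c : N.Chain} (h : unitFlow c' c ≠ 0) : c = c' :=
  Set.mem_singleton_iff.1 (Set.mem_of_indicator_ne_zero (s := {c'}) h)

theorem sum_unitFlow [Fintype Φ] (g : N.Chain → ℝ) (c : N.Chain) :
    ∑ c', unitFlow c' c * g c' = g c := by
  rw [Finset.sum_eq_single c _ (by simp)]
  · simp [unitFlow]
  · intro c' _ h
    rw [not_ne_iff.1 (mt eq_of_unitFlow_ne_zero h.symm), zero_mul]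

theorem processed_nonneg {g : N.Chain → ℝ} (hg : ∀ c, 0 ≤ g c) (c : N.Chain) :
    0 ≤ processed g c := by
  obtain ⟨φ, m, D⟩ := c
  induction m using Fin.cases with
  | zero => simp [processed]
  | succ m => exact mul_nonneg (N.scaling_nonneg _ _) (hg _)

/-- Processing keeps the destination set. -/
theorem dest_eq_of_processed_ne_zero {c' c : N.Chain}
    (h : processed (unitFlow c') c ≠ 0) : c'.dest = c.dest := by
  obtain ⟨φ, m, D⟩ := c
  induction m using Fin.cases with
  | zero => simp [processed] at h
  | succ m =>
    have h' : unitFlow c' ⟨φ, m.castSucc, D⟩ ≠ 0 := right_ne_zero_of_mul h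
    rw [← eq_of_unitFlow_ne_zero h']; rfl

theorem processed_eq_sum [Fintype Φ] (g : N.Chain → ℝ) (c : N.Chain) :
    processed g c = ∑ c', processed (unitFlow c') c * g c' := by
  obtain ⟨φ, m, D⟩ := c
  induction m using Fin.cases with
  | zero => simp [processed]
  | succ m =>
    change N.scaling φ m * g ⟨φ, m.castSucc, D⟩ = ∑ c',
      N.scaling φ m * unitFlow c' ⟨φ, m.castSucc, D⟩ * g c'
    simp_rw [mul_assoc, ← Finset.mul_sum, sum_unitFlow]

theorem usage_eq [Fintype V] [Fintype Φ] (f : N.Interface → N.Chain → Finset V → ℝ) (ι : N.Interface) :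
    usage f ι = ∑ c, resource ι c * ∑ q, f ι c q := by
  rcases ι with i | e <;> simp [usage, resource, Finset.mul_sum]

theorem cost_eq [Fintype V] [Fintype Φ] (f : N.Interface → N.Chain → Finset V → ℝ) :
    cost f = ∑ ι, price ι * usage f ι := by
  rw [Fintype.sum_sum_type]; rfl

variable [DecidableEq V]

theorem deliver_nonneg (ι : N.Interface) (c' : N.Chain) (j : V) (c : N.Chain) :
    0 ≤ deliver ι c' j c := by
  rcases ι with i | e
  · simp only [deliver]; split_ifs
    exacts [processed_nonneg (unitFlow_nonneg _) c, le_rfl]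
  · simp only [deliver]; split_ifs
    exacts [unitFlow_nonneg _ _, le_rfl]

theorem dest_eq_of_deliver_ne_zero {ι : N.Interface} {c' : N.Chain} {j : V} {c : N.Chain}
    (h : deliver ι c' j c ≠ 0) : c'.dest = c.dest := by
  rcases ι with i | e
  · simp only [deliver] at h; split_ifs at h
    exacts [dest_eq_of_processed_ne_zero h, absurd rfl h]
  · simp only [deliver] at h; split_ifs at h
    exacts [by rw [eq_of_unitFlow_ne_zero h], absurd rfl h]

variable [Fintype V]

theorem netOut_eq (f : N.Interface → N.Chain → Finset V → ℝ) (i : V) (c : N.Chain)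
    (q : Finset V) : netOut f i c q = ∑ ι with source ι = i, f ι c q := by
  rw [Finset.sum_filter, Fintype.sum_sum_type]
  have h : (∑ j, if source (N := N) (Sum.inl j) = i then f (Sum.inl j) c q else 0) =
      f (Sum.inl i) c q :=
    (Finset.sum_eq_single i (fun j _ h => if_neg h)
      fun h => absurd (Finset.mem_univ i) h).trans (if_pos rfl)
  rw [h, netOut, Finset.sum_filter]
  rfl

theorem rateOut_eq (f : N.FlowVector) (i : V) (c : N.Chain) (q : Finset V) :
    rateOut f i c q = ∑ s ∈ q.powerset, ∑ ι with source ι = i, f ι c q s :=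
  Finset.sum_congr rfl fun s _ => netOut_eq (fun ι c s => f ι c q s) i c s

theorem netOut_nonneg {f : N.Interface → N.Chain → Finset V → ℝ} (hf : ∀ ι c q, 0 ≤ f ι c q)
    (i : V) (c : N.Chain) (q : Finset V) : 0 ≤ netOut f i c q := by
  rw [netOut_eq]
  exact Finset.sum_nonneg fun ι _ => hf ι c q

variable [Fintype Φ]

theorem sum_deliver (g : N.Interface → N.Chain → ℝ) (j : V) (c : N.Chain) :
    ∑ ι, ∑ c', deliver ι c' j c * g ι c' = processed (g (Sum.inl j)) c +
      ∑ e : N.Link with e.1.2 = j, g (Sum.inr e) c := by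
  rw [Fintype.sum_sum_type, Finset.sum_filter]
  congr 1
  · rw [Finset.sum_eq_single j _ (by simp)]
    · simp only [deliver, if_true, ← processed_eq_sum]
    · intro i _ h
      simp [deliver, h]
  · refine Finset.sum_congr rfl fun e _ => ?_
    simp only [deliver]
    split_ifs <;> simp [sum_unitFlow]

theorem netIn_eq (f : N.Interface → N.Chain → Finset V → ℝ) (j : V) (c : N.Chain)
    (q : Finset V) : netIn f j c q = ∑ ι, ∑ c', deliver ι c' j c * f ι c' q :=
  (sum_deliver (fun ι c' => f ι c' q) j c).symm

theorem rateIn_eq (f : N.FlowVector) (i : V) (c : N.Chain) (q : Finset V) :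
    rateIn f i c q = (∑ s ∈ (c.dest \ q).powerset,
      ∑ ι, ∑ c', deliver ι c' i c * f ι c' (q ∪ s) q) +
      ∑ s ∈ (c.dest \ q).powerset, ∑ ι with source ι = i, f ι c (q ∪ s) s := by
  rw [← Finset.sum_add_distrib]
  refine Finset.sum_congr rfl fun s _ => ?_
  rw [sum_deliver (fun ι c' => f ι c' (q ∪ s) q) i c]
  have := netOut_eq (fun ι c s => f ι c (q ∪ s) s) i c s
  rw [← this, netOut]
  ring

end Interfaces

/-! ### Efficient flows -/

section EfficientFlows

variable {V : Type u} {Φ : Type v} [Fintype V] [Fintype Φ] {N : CloudNetwork V Φ}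

/-- The amounts of the commodities that are operated by the flow variables `f`: the copies of
status `s` are taken from packets of any status `q`. -/
def operated (f : N.FlowVector) (ι : N.Interface) (c : N.Chain) (s : Finset V) : ℝ :=
  ∑ q, f ι c q s

variable [DecidableEq V]

/-- The conditions on the flow variables alone: the selection probabilities are eliminated in favour
of the capacity constraints. At a destination of a final `c` nothing is taken from the statuses
that contain this node; the balance there says nothing about them, so this is an extra condition. -/
structure IsEfficientFlow (lam : N.ArrivalVector) (f : N.FlowVector) : Prop where
  nonneg : ∀ ι c q s, 0 ≤ f ι c q s
  support : ∀ ι c q s, f ι c q s ≠ 0 → Selectable ι c q s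
  conservation : ∀ i c, QueueBalance i c (fun q => rateIn f i c q + lam i c q)
    (fun q => rateOut f i c q)
  consumed : ∀ ι (c : N.Chain) q s, c.IsFinal → source ι ∈ q → f ι c q s = 0
  usage_le : ∀ ι, usage (operated f) ι ≤ capacity ι

theorem IsFeasible.le_fullAmount_mul {lam : N.ArrivalVector} {f : N.FlowVector}
    {β : N.SelectionProb} (h : IsFeasible lam f β) (ι : N.Interface) (c : N.Chain)
    (q s : Finset V) : f ι c q s ≤ fullAmount ι c * β.val ι c q s := by
  rcases ι with i | e
  · by_cases hc : c.IsFinal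
    · have : f (Sum.inl i) c q s = 0 := by
        by_contra h'
        exact (h.support _ _ _ _ h').1 hc
      rw [this]
      exact mul_nonneg (fullAmount_nonneg _ _) (β.nonneg _ _ _ _)
    · exact h.node_le i c hc q s
  · rw [mul_comm]
    exact h.link_le e c q s

theorem rateIn_mono {f g : N.FlowVector} (h : ∀ ι c q s, f ι c q s ≤ g ι c q s) (i : V)
    (c : N.Chain) (q : Finset V) : rateIn f i c q ≤ rateIn g i c q := by
  rw [rateIn_eq, rateIn_eq]
  gcongr
  · exact deliver_nonneg _ _ _ _
  · exact h _ _ _ _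
  · exact h _ _ _ _

omit [DecidableEq V] in
theorem SelectionProb.sum_sum_le_one (β : N.SelectionProb) (ι : N.Interface) :
    ∑ c, ∑ s, ∑ q, β.val ι c q s ≤ 1 := by
  refine le_trans (le_of_eq ?_) (β.sum_le_one ι)
  rw [Fintype.sum_prod_type]
  refine Finset.sum_congr rfl fun c _ => ?_
  rw [Fintype.sum_prod_type]
  exact Finset.sum_comm

/-- Flow variables with selection probabilities give an efficient flow, after the useless operations
on packets that have already been consumed are dropped. -/
theorem IsFeasible.exists_isEfficientFlow {lam : N.ArrivalVector} {f : N.FlowVector}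
    {β : N.SelectionProb} (h : IsFeasible lam f β) : ∃ g, IsEfficientFlow lam g := by
  let g : N.FlowVector := fun ι c q s => if c.IsFinal ∧ source ι ∈ q then 0 else f ι c q s
  have hg : ∀ ι c q s, g ι c q s ≤ f ι c q s := fun ι c q s => by
    simp only [g]; split_ifs
    exacts [h.nonneg _ _ _ _, le_rfl]
  have hout : ∀ i (c : N.Chain) q, ¬ (c.IsFinal ∧ i ∈ q) →
      rateOut g i c q = rateOut f i c q := by
    intro i c q hq
    rw [rateOut_eq, rateOut_eq]
    refine Finset.sum_congr rfl fun s _ => Finset.sum_congr rfl fun ι hι => ?_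
    rw [← (Finset.mem_filter.1 hι).2] at hq
    exact if_neg hq
  refine ⟨g, fun ι c q s => ?_, fun ι c q s hne => ?_, fun i c q hq hqD => ⟨fun hc => ?_,
    fun hc hiq => ?_⟩, fun ι c q s hc hι => if_pos ⟨hc, hι⟩, fun ι => ?_⟩
  · simp only [g]; split_ifs
    exacts [le_rfl, h.nonneg _ _ _ _]
  · simp only [g] at hne; split_ifs at hne
    exacts [absurd rfl hne, h.support _ _ _ _ hne]
  · dsimp only
    rw [hout i c q fun h' => hc ⟨h'.1, hqD h'.2⟩]
    exact (add_le_add_left (rateIn_mono hg i c q) _).trans ((h.conservation i c q hq hqD).1 hc)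
  · dsimp only
    rw [hout i c q fun h' => hiq h'.2]
    exact (add_le_add (add_le_add_left (rateIn_mono hg i c q) _)
      (add_le_add_left (rateIn_mono hg i c _) _)).trans
      ((h.conservation i c q hq hqD).2 hc hiq)
  · rw [usage_eq]
    calc ∑ c, resource ι c * ∑ s, operated g ι c s
        ≤ ∑ c, capacity ι * ∑ s, ∑ q, β.val ι c q s := by
          refine Finset.sum_le_sum fun c _ => ?_
          simp only [operated, Finset.mul_sum]
          refine Finset.sum_le_sum fun s _ => Finset.sum_le_sum fun q _ => ?_
          refine (mul_le_mul_of_nonneg_left ((hg ι c q s).trans (h.le_fullAmount_mul ι c q s))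
            (resource_nonneg ι c)).trans ?_
          rw [fullAmount_eq, ← mul_assoc]
          refine mul_le_mul_of_nonneg_right ?_ (β.nonneg _ _ _ _)
          rcases eq_or_ne (resource ι c) 0 with h0 | h0
          · rw [h0, zero_mul]; exact capacity_nonneg ι
          · rw [mul_div_cancel₀ _ h0]
      _ ≤ capacity ι * 1 := by
          rw [← Finset.mul_sum]
          exact mul_le_mul_of_nonneg_left (β.sum_sum_le_one ι) (capacity_nonneg ι)
      _ = capacity ι := mul_one _

omit [DecidableEq V] in
theorem usage_operated (f : N.FlowVector) (ι : N.Interface) :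
    usage (operated f) ι = ∑ a : N.Chain × Finset V × Finset V,
      f ι a.1 a.2.1 a.2.2 * resource ι a.1 := by
  rw [usage_eq, Fintype.sum_prod_type]
  refine Finset.sum_congr rfl fun c _ => ?_
  rw [Fintype.sum_prod_type, Finset.sum_comm, Finset.mul_sum]
  exact Finset.sum_congr rfl fun q _ => by rw [operated, Finset.mul_sum]; simp only [mul_comm]

/-- The probabilities with which each interface, using all its resource on its choice, realizes the
flow `f` on average. -/
noncomputable def IsEfficientFlow.selection {lam : N.ArrivalVector} {f : N.FlowVector}
    (h : IsEfficientFlow lam f) : N.SelectionProb where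
  val ι c q s := f ι c q s * resource ι c / capacity ι
  nonneg ι c q s := div_nonneg (mul_nonneg (h.nonneg _ _ _ _) (resource_nonneg _ _))
    (capacity_nonneg ι)
  support ι c q s hne := h.support ι c q s fun h0 => hne (by rw [h0, zero_mul, zero_div])
  sum_le_one ι := by
    rw [← Finset.sum_div, ← usage_operated]
    exact div_le_one_of_le₀ (h.usage_le ι) (capacity_nonneg ι)

theorem IsEfficientFlow.fullAmount_mul_selection {lam : N.ArrivalVector} {f : N.FlowVector}
    (h : IsEfficientFlow lam f) (ι : N.Interface) (c : N.Chain) (q s : Finset V) :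
    fullAmount ι c * h.selection.val ι c q s = f ι c q s := by
  rw [fullAmount_eq]
  simp only [selection]
  rcases eq_or_ne (f ι c q s) 0 with h0 | h0
  · rw [h0, zero_mul, zero_div, mul_zero]
  have hr := resource_pos (h.support _ _ _ _ h0).1
  -- an interface without resource cannot carry a positive flow
  have hcap : capacity ι ≠ 0 := by
    intro hcap
    have h1 := h.usage_le ι
    rw [usage_operated, hcap] at h1
    have h2 := Finset.single_le_sum (f := fun a : N.Chain × Finset V × Finset V =>
      f ι a.1 a.2.1 a.2.2 * resource ι a.1)
      (fun a _ => mul_nonneg (h.nonneg _ _ _ _) (resource_nonneg _ _))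
      (Finset.mem_univ (c, q, s))
    have h3 := mul_pos (lt_of_le_of_ne (h.nonneg _ _ _ _) h0.symm) hr
    exact absurd (h2.trans h1) (not_le.2 h3)
  have hr' := hr.ne'
  field_simp

theorem IsEfficientFlow.isFeasible {lam : N.ArrivalVector} {f : N.FlowVector}
    (h : IsEfficientFlow lam f) : IsFeasible lam f h.selection where
  nonneg := h.nonneg
  support := h.support
  conservation := h.conservation
  node_le i c _ q s := (h.fullAmount_mul_selection (Sum.inl i) c q s).ge
  link_le e c q s := by
    rw [mul_comm]
    exact (h.fullAmount_mul_selection (Sum.inr e) c q s).ge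

end EfficientFlows

/-! ### Averages over the sample space and over time -/

section Averages

variable {V : Type u} {Φ : Type v} [Fintype V] [DecidableEq V] [Fintype Φ] {N : CloudNetwork V Φ}
variable {Ω : Type*} [MeasurableSpace Ω] {P : Measure Ω}

theorem integral_netIn {F : Ω → N.Interface → N.Chain → Finset V → ℝ}
    (hF : ∀ ι c q, Integrable (fun ω => F ω ι c q) P) (i : V) (c : N.Chain) (q : Finset V) :
    ∫ ω, netIn (F ω) i c q ∂P = netIn (fun ι c q => ∫ ω, F ω ι c q ∂P) i c q := by
  simp only [netIn_eq]
  rw [integral_finsetSum _ fun ι _ => integrable_finsetSum _ fun c' _ => (hF _ _ _).const_mul _]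
  refine Finset.sum_congr rfl fun ι _ => ?_
  rw [integral_finsetSum _ fun c' _ => (hF _ _ _).const_mul _]
  simp only [integral_const_mul]

omit [Fintype Φ] in
theorem integral_netOut {F : Ω → N.Interface → N.Chain → Finset V → ℝ}
    (hF : ∀ ι c q, Integrable (fun ω => F ω ι c q) P) (i : V) (c : N.Chain) (q : Finset V) :
    ∫ ω, netOut (F ω) i c q ∂P = netOut (fun ι c q => ∫ ω, F ω ι c q ∂P) i c q := by
  simp only [netOut_eq]
  rw [integral_finsetSum _ fun ι _ => hF _ _ _]

omit [DecidableEq V] in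
theorem integral_usage {F : Ω → N.Interface → N.Chain → Finset V → ℝ}
    (hF : ∀ ι c q, Integrable (fun ω => F ω ι c q) P) (ι : N.Interface) :
    ∫ ω, usage (F ω) ι ∂P = usage (fun ι c q => ∫ ω, F ω ι c q ∂P) ι := by
  simp only [usage_eq]
  rw [integral_finsetSum _ fun c _ => (integrable_finsetSum _ fun q _ => hF _ _ _).const_mul _]
  refine Finset.sum_congr rfl fun c _ => ?_
  rw [integral_const_mul, integral_finsetSum _ fun q _ => hF _ _ _]

omit [DecidableEq V] in
theorem integrable_usage {F : Ω → N.Interface → N.Chain → Finset V → ℝ}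
    (hF : ∀ ι c q, Integrable (fun ω => F ω ι c q) P) (ι : N.Interface) :
    Integrable (fun ω => usage (F ω) ι) P := by
  simp only [usage_eq]
  exact integrable_finsetSum _ fun c _ => (integrable_finsetSum _ fun q _ => hF _ _ _).const_mul _

omit [DecidableEq V] in
theorem integral_cost {F : Ω → N.Interface → N.Chain → Finset V → ℝ}
    (hF : ∀ ι c q, Integrable (fun ω => F ω ι c q) P) :
    ∫ ω, cost (F ω) ∂P = cost (fun ι c q => ∫ ω, F ω ι c q ∂P) := by
  simp only [cost_eq]
  rw [integral_finsetSum _ fun ι _ => (integrable_usage hF ι).const_mul _]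
  simp only [integral_const_mul, integral_usage hF]

omit [DecidableEq V] in
theorem integral_copiesIn {d : Ω → Finset V → Finset V → Finset V → ℝ}
    (hd : ∀ q s r, Integrable (fun ω => d ω q s r) P) (q : Finset V) :
    ∫ ω, copiesIn (d ω) q ∂P = copiesIn (fun q s r => ∫ ω, d ω q s r ∂P) q := by
  simp only [copiesIn]
  rw [integral_add (integrable_finsetSum _ fun _ _ => integrable_finsetSum _ fun _ _ => hd _ _ _)
    (integrable_finsetSum _ fun _ _ => integrable_finsetSum _ fun _ _ => hd _ _ _),
    integral_finsetSum _ fun _ _ => integrable_finsetSum _ fun _ _ => hd _ _ _,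
    integral_finsetSum _ fun _ _ => integrable_finsetSum _ fun _ _ => hd _ _ _]
  congr 1 <;>
  exact Finset.sum_congr rfl fun _ _ => integral_finsetSum _ fun _ _ => hd _ _ _

omit [DecidableEq V] in
theorem integral_copiesOut {d : Ω → Finset V → Finset V → Finset V → ℝ}
    (hd : ∀ q s r, Integrable (fun ω => d ω q s r) P) (q : Finset V) :
    ∫ ω, copiesOut (d ω) q ∂P = copiesOut (fun q s r => ∫ ω, d ω q s r ∂P) q := by
  simp only [copiesOut]
  rw [integral_finsetSum _ fun _ _ => integrable_finsetSum _ fun _ _ => hd _ _ _]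
  exact Finset.sum_congr rfl fun _ _ => integral_finsetSum _ fun _ _ => hd _ _ _

theorem hasLongTermAvg_const (x : ℝ) : HasLongTermAvg (fun _ => x) x := by
  refine tendsto_const_nhds.congr' ?_
  filter_upwards [eventually_ge_atTop 1] with T hT
  have : (T : ℝ) ≠ 0 := by positivity
  simp [this]

end Averages

/-! ### Duplication and flow conservation at a node -/

section Copies

variable {V : Type u} [Fintype V]

theorem sum_mul_copiesIn (d : Finset V → Finset V → Finset V → ℝ) (w : Finset V → ℝ) :
    ∑ q, w q * copiesIn d q = ∑ p, ∑ s, ∑ r, d p s r * (w s + w r) := by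
  simp only [copiesIn, mul_add, Finset.sum_add_distrib, Finset.mul_sum]
  congr 1
  · rw [Finset.sum_comm]
    simp only [mul_comm]
  · rw [Finset.sum_comm]
    refine Finset.sum_congr rfl fun p _ => ?_
    rw [Finset.sum_comm]
    simp only [mul_comm]

theorem copiesOut_nonneg {d : Finset V → Finset V → Finset V → ℝ} (hd : ∀ q s r, 0 ≤ d q s r)
    (q : Finset V) : 0 ≤ copiesOut d q :=
  Finset.sum_nonneg fun _ _ => Finset.sum_nonneg fun _ _ => hd _ _ _

variable [DecidableEq V]

/-- A packet with `k` in its status that is duplicated is replaced by at least one packet with `k`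
in its status, because the copies cover the original packet. -/
theorem sum_copiesOut_le_sum_copiesIn {D : Finset V} {d : Finset V → Finset V → Finset V → ℝ}
    (hd : ∀ q s r, 0 ≤ d q s r) (hcov : ∀ q s r, d q s r ≠ 0 → s ⊆ D ∧ r ⊆ D ∧ q ⊆ s ∪ r)
    (k : V) :
    ∑ q ∈ D.powerset with k ∈ q, copiesOut d q ≤ ∑ q ∈ D.powerset with k ∈ q, copiesIn d q := by
  let w : Finset V → ℝ := fun q => if q ⊆ D ∧ k ∈ q then 1 else 0
  have hw : ∀ g : Finset V → ℝ, ∑ q ∈ D.powerset with k ∈ q, g q = ∑ q, w q * g q := by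
    intro g
    simp only [w, ite_mul, one_mul, zero_mul, ← Finset.sum_filter]
    refine Finset.sum_congr (Finset.ext fun q => ?_) fun _ _ => rfl
    simp
  have hw0 : ∀ q, 0 ≤ w q := fun q => by simp only [w]; split_ifs <;> simp
  have hw1 : ∀ q, w q ≤ 1 := fun q => by simp only [w]; split_ifs <;> simp
  rw [hw, hw, sum_mul_copiesIn]
  simp only [copiesOut, Finset.mul_sum]
  refine Finset.sum_le_sum fun q _ => Finset.sum_le_sum fun s _ => Finset.sum_le_sum fun r _ => ?_
  rw [mul_comm]
  rcases eq_or_ne (d q s r) 0 with h | h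
  · simp [h]
  refine mul_le_mul_of_nonneg_left ?_ (hd q s r)
  obtain ⟨hs, hr, hq⟩ := hcov q s r h
  by_cases hk : k ∈ q
  · rcases Finset.mem_union.1 (hq hk) with h' | h'
    · have : w s = 1 := if_pos ⟨hs, h'⟩
      linarith [hw1 q, hw0 r]
    · have : w r = 1 := if_pos ⟨hr, h'⟩
      linarith [hw1 q, hw0 s]
  · have : w q = 0 := if_neg fun h' => hk h'.2
    linarith [hw0 s, hw0 r]

theorem sum_superset (D q : Finset V) (g : Finset V → ℝ)
    (hg : ∀ p, g p ≠ 0 → q ⊆ p ∧ p ⊆ D) : ∑ p, g p = ∑ s ∈ (D \ q).powerset, g (q ∪ s) := by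
  symm
  refine Finset.sum_bij_ne_zero (fun s _ _ => q ∪ s) (fun _ _ _ => Finset.mem_univ _) ?_ ?_
    fun _ _ _ => rfl
  · intro s hs _ t ht _ h
    have hs' : Disjoint q s :=
      Finset.disjoint_sdiff.mono_right (Finset.mem_powerset.1 hs)
    have ht' : Disjoint q t :=
      Finset.disjoint_sdiff.mono_right (Finset.mem_powerset.1 ht)
    rw [← Finset.union_sdiff_cancel_left hs', h, Finset.union_sdiff_cancel_left ht']
  · intro p _ hp
    obtain ⟨h1, h2⟩ := hg p hp
    refine ⟨p \ q, Finset.mem_powerset.2 (Finset.sdiff_subset_sdiff h2 subset_rfl), ?_, ?_⟩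
    · rwa [Finset.union_sdiff_of_subset h1]
    · rw [Finset.union_sdiff_of_subset h1]

end Copies

section Law

variable {V : Type u} {Φ : Type v} [Fintype V] [DecidableEq V] {N : CloudNetwork V Φ}

/-- The generalized flow conservation law follows from the balance of the queues. -/
theorem sum_le_sum_of_queueBalance {i : V} {c : N.Chain} {fIn fOut : Finset V → ℝ}
    {d : Finset V → Finset V → Finset V → ℝ} (hd : ∀ q s r, 0 ≤ d q s r)
    (hcov : ∀ q s r, d q s r ≠ 0 → s ⊆ c.dest ∧ r ⊆ c.dest ∧ q ⊆ s ∪ r)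
    (hOut : ∀ q, 0 ≤ fOut q)
    (hbal : QueueBalance i c (fun q => fIn q + copiesIn d q) (fun q => fOut q + copiesOut d q))
    {k : V} (hk : ¬ (c.IsFinal ∧ i = k)) :
    ∑ q ∈ c.dest.powerset with k ∈ q, fIn q ≤ ∑ q ∈ c.dest.powerset with k ∈ q, fOut q := by
  suffices h : ∑ q ∈ c.dest.powerset with k ∈ q, (fIn q + copiesIn d q) ≤
      ∑ q ∈ c.dest.powerset with k ∈ q, (fOut q + copiesOut d q) by
    rw [Finset.sum_add_distrib, Finset.sum_add_distrib] at h
    linarith [sum_copiesOut_le_sum_copiesIn hd hcov k]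
  set A := c.dest.powerset.filter (k ∈ ·) with hA
  have hmem : ∀ q, q ∈ A ↔ q ⊆ c.dest ∧ k ∈ q := fun q => by simp [hA]
  by_cases habs : c.IsFinal ∧ i ∈ c.dest
  · have hik : k ≠ i := fun h => hk ⟨habs.1, h.symm⟩
    have hsplit : ∑ q ∈ A with i ∈ q, (fIn q + copiesIn d q) =
        ∑ q ∈ A with i ∉ q, (fIn (insert i q) + copiesIn d (insert i q)) := by
      refine Finset.sum_bij' (fun q _ => q.erase i) (fun q _ => insert i q) ?_ ?_ ?_ ?_ ?_
      · intro q hq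
        obtain ⟨h1, h2⟩ := Finset.mem_filter.1 hq
        obtain ⟨h3, h4⟩ := (hmem q).1 h1
        exact Finset.mem_filter.2 ⟨(hmem _).2 ⟨(Finset.erase_subset _ _).trans h3,
          Finset.mem_erase.2 ⟨hik, h4⟩⟩, Finset.notMem_erase _ _⟩
      · intro q hq
        obtain ⟨h1, h2⟩ := Finset.mem_filter.1 hq
        obtain ⟨h3, h4⟩ := (hmem q).1 h1
        exact Finset.mem_filter.2 ⟨(hmem _).2 ⟨Finset.insert_subset habs.2 h3,
          Finset.mem_insert_of_mem h4⟩, Finset.mem_insert_self _ _⟩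
      · intro q hq
        exact Finset.insert_erase (Finset.mem_filter.1 hq).2
      · intro q hq
        exact Finset.erase_insert (Finset.mem_filter.1 hq).2
      · intro q hq
        rw [Finset.insert_erase (Finset.mem_filter.1 hq).2]
    rw [← Finset.sum_filter_add_sum_filter_not A (i ∈ ·), hsplit, ← Finset.sum_add_distrib]
    refine (Finset.sum_le_sum fun q hq => ?_).trans
      (Finset.sum_le_sum_of_subset_of_nonneg (Finset.filter_subset (i ∉ ·) A)
        fun q _ _ => add_nonneg (hOut q) (copiesOut_nonneg hd q))
    obtain ⟨h1, h2⟩ := Finset.mem_filter.1 hq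
    obtain ⟨h3, h4⟩ := (hmem q).1 h1
    have := (hbal q ⟨k, h4⟩ h3).2 habs h2
    dsimp only at this
    linarith
  · refine Finset.sum_le_sum fun q hq => ?_
    obtain ⟨h3, h4⟩ := (hmem q).1 hq
    exact (hbal q ⟨k, h4⟩ h3).1 habs

end Law

/-! ### The stationary randomized policy of an efficient flow -/

section Stationary

variable {V : Type u} {Φ : Type v} [Fintype V] [Fintype Φ] {N : CloudNetwork V Φ}

theorem integral_choiceDecision (β : N.SelectionProb) (t : ℕ) (ι : N.Interface) (c : N.Chain)
    (q s : Finset V) : Integrable (fun ω => choiceDecision t ω ι c q s) β.measure ∧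
      ∫ ω, choiceDecision t ω ι c q s ∂β.measure = fullAmount ι c * β.val ι c q s := by
  have hmp : MeasurePreserving (Function.eval (t, ι)) β.measure (β.law ι).toMeasure :=
    measurePreserving_eval_infinitePi (fun p : ℕ × N.Interface => (β.law p.2).toMeasure) (t, ι)
  have hms : MeasurableSet {o : N.Choice | o = some (c, q, s)} := trivial
  have hi : Integrable (Set.indicator {o : N.Choice | o = some (c, q, s)}
      fun _ => fullAmount ι c) (β.law ι).toMeasure :=
    (integrable_const _).indicator hms
  refine ⟨hmp.integrable_comp_of_integrable hi, ?_⟩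
  have h1 : ∫ ω, choiceDecision t ω ι c q s ∂β.measure =
      ∫ o, Set.indicator {o : N.Choice | o = some (c, q, s)} (fun _ => fullAmount ι c) o
        ∂(β.law ι).toMeasure := by
    rw [← hmp.map_eq]
    exact (integral_map hmp.measurable.aemeasurable
      (hmp.map_eq ▸ hi.aestronglyMeasurable)).symm
  rw [h1, integral_indicator hms, setIntegral_const, smul_eq_mul, mul_comm]
  congr 1
  have : (β.law ι).toMeasure {o : N.Choice | o = some (c, q, s)} =
      ENNReal.ofReal (β.val ι c q s) :=
    (PMF.toMeasure_apply_singleton (β.law ι) (some (c, q, s)) hms).trans rfl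
  rw [Measure.real, this, ENNReal.toReal_ofReal (β.nonneg _ _ _ _)]

omit [Fintype V] [Fintype Φ] in
theorem choiceDecision_nonneg (t : ℕ) (ω : N.ChoiceSpace) (ι : N.Interface) (c : N.Chain)
    (q s : Finset V) : 0 ≤ choiceDecision t ω ι c q s :=
  Set.indicator_nonneg (fun _ _ => fullAmount_nonneg _ _) _

/-- Almost surely, an interface only chooses what it can operate. -/
theorem ae_selectable (β : N.SelectionProb) (t : ℕ) :
    ∀ᵐ ω ∂β.measure, ∀ ι c q s, choiceDecision t ω ι c q s ≠ 0 → Selectable ι c q s := by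
  simp only [ae_all_iff]
  intro ι c q s
  by_cases h : Selectable ι c q s
  · exact ae_of_all _ fun _ _ => h
  · have h0 : β.val ι c q s = 0 := by
      by_contra h'
      exact h (β.support _ _ _ _ h')
    obtain ⟨hi, he⟩ := integral_choiceDecision β t ι c q s
    rw [h0, mul_zero] at he
    have he := (integral_eq_zero_iff_of_nonneg
      (fun ω => choiceDecision_nonneg t ω ι c q s) hi).1 he
    filter_upwards [he] with ω hω h'
    exact absurd hω h'

theorem usage_choiceDecision_le [DecidableEq V] (t : ℕ) (ω : N.ChoiceSpace) (ι : N.Interface) :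
    usage (operated (choiceDecision t ω)) ι ≤ capacity ι := by
  rw [usage_operated]
  rcases h : ω (t, ι) with _ | a
  · refine (Finset.sum_eq_zero fun b _ => ?_).trans_le (capacity_nonneg ι)
    have : choiceDecision t ω ι b.1 b.2.1 b.2.2 = 0 := by
      refine Set.indicator_of_notMem ?_ _
      rw [h]
      exact fun h' => by cases h'
    rw [this, zero_mul]
  · rw [Finset.sum_eq_single a]
    · have : choiceDecision t ω ι a.1 a.2.1 a.2.2 = fullAmount ι a.1 := by
        refine Set.indicator_of_mem ?_ _
        exact h
      rw [this, fullAmount_eq]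
      rcases eq_or_ne (resource ι a.1) 0 with h0 | h0
      · rw [h0, mul_zero]; exact capacity_nonneg ι
      · rw [div_mul_cancel₀ _ h0]
    · intro b _ hb
      have : choiceDecision t ω ι b.1 b.2.1 b.2.2 = 0 := by
        refine Set.indicator_of_notMem ?_ _
        rw [h]
        intro h'
        exact hb (Option.some.inj h').symm
      rw [this, zero_mul]
    · simp

variable [DecidableEq V]

/-- The duplications that go with the flow variables `f`: the packets of status `q` from which
copies of status `s ≠ q` are operated are split into `s` and `q \ s`. -/
def duplications (f : N.FlowVector) (i : V) (c : N.Chain) (q s r : Finset V) : ℝ :=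
  if s ≠ q ∧ r = q \ s then netOut (fun ι c s => f ι c q s) i c s else 0

omit [Fintype Φ] in
theorem duplications_coverage {f : N.FlowVector} {i : V} {c : N.Chain} {q s r : Finset V}
    (hf : ∀ ι c q s, f ι c q s ≠ 0 → Selectable ι c q s) (h : duplications f i c q s r ≠ 0) :
    q.Nonempty ∧ s.Nonempty ∧ r.Nonempty ∧ q ⊆ c.dest ∧ s ⊆ c.dest ∧ r ⊆ c.dest ∧
      q ⊆ s ∪ r := by
  simp only [duplications] at h
  split_ifs at h with h1
  · obtain ⟨hsq, rfl⟩ := h1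
    rw [netOut_eq] at h
    obtain ⟨ι, _, hι⟩ := Finset.exists_ne_zero_of_sum_ne_zero h
    obtain ⟨_, hs, hsub, hq⟩ := hf _ _ _ _ hι
    refine ⟨hs.mono hsub, hs, ?_, hq, hsub.trans hq, Finset.sdiff_subset.trans hq, ?_⟩
    · rw [Finset.sdiff_nonempty]
      exact fun h' => hsq (hsub.antisymm h')
    · rw [Finset.union_sdiff_of_subset hsub]
  · exact absurd rfl h

omit [Fintype Φ] in
theorem duplications_nonneg {f : N.FlowVector} (hf : ∀ ι c q s, 0 ≤ f ι c q s) (i : V)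
    (c : N.Chain) (q s r : Finset V) : 0 ≤ duplications f i c q s r := by
  simp only [duplications]
  split_ifs
  exacts [netOut_nonneg (fun _ _ _ => hf _ _ _ _) _ _ _, le_rfl]

/-- The packets taken from the queue of status `q` are duplicated, unless all of their destinations
are operated at once. -/
theorem copiesOut_duplications {lam : N.ArrivalVector} {f : N.FlowVector}
    (h : IsEfficientFlow lam f) (i : V) (c : N.Chain) (q : Finset V) :
    copiesOut (duplications f i c) q + netOut (fun ι c s => f ι c q s) i c q =
      rateOut f i c q := by
  have h1 : copiesOut (duplications f i c) q =
      ∑ s, if s ≠ q then netOut (fun ι c s => f ι c q s) i c s else 0 := by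
    refine Finset.sum_congr rfl fun s _ => ?_
    by_cases hs : s = q <;> simp [duplications, hs]
  have h2 : rateOut f i c q = ∑ s, netOut (fun ι c s => f ι c q s) i c s := by
    rw [rateOut_eq]
    simp only [netOut_eq]
    refine Finset.sum_subset (Finset.subset_univ _) fun s _ hs => Finset.sum_eq_zero fun ι _ => ?_
    by_contra h'
    exact hs (Finset.mem_powerset.2 (h.support _ _ _ _ h').2.2.1)
  rw [h1, h2, ← Finset.sum_filter, Finset.filter_ne', ← Finset.sum_erase_add _ _
    (Finset.mem_univ q)]

/-- The packets that enter the queue of status `q`, counted as received packets and as copies,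
compared with `rateIn`: the copies of status `q` that are operated at once are not part of the
latter. -/
theorem netIn_add_copiesIn {lam : N.ArrivalVector} {f : N.FlowVector}
    (h : IsEfficientFlow lam f) (i : V) (c : N.Chain) {q : Finset V} (hq : q.Nonempty) :
    netIn (operated f) i c q + copiesIn (duplications f i c) q +
        netOut (fun ι c s => f ι c q s) i c q =
      rateIn f i c q + netOut (operated f) i c q := by
  let out : Finset V → Finset V → ℝ := fun p s => netOut (fun ι c s => f ι c p s) i c s
  have hout : ∀ p s, out p s ≠ 0 → s.Nonempty ∧ s ⊆ p ∧ p ⊆ c.dest := by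
    intro p s hps
    simp only [out, netOut_eq] at hps
    obtain ⟨ι, _, hι⟩ := Finset.exists_ne_zero_of_sum_ne_zero hps
    exact (h.support _ _ _ _ hι).2
  have h1 : netIn (operated f) i c q =
      ∑ s ∈ (c.dest \ q).powerset, ∑ ι, ∑ c', deliver ι c' i c * f ι c' (q ∪ s) q := by
    rw [← sum_superset c.dest q (fun p => ∑ ι, ∑ c', deliver ι c' i c * f ι c' p q),
      Finset.sum_comm, netIn_eq]
    · refine Finset.sum_congr rfl fun ι _ => ?_
      rw [Finset.sum_comm]
      simp only [operated, Finset.mul_sum]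
    · intro p hp
      obtain ⟨ι, _, hp⟩ := Finset.exists_ne_zero_of_sum_ne_zero hp
      obtain ⟨c', _, hp⟩ := Finset.exists_ne_zero_of_sum_ne_zero hp
      rw [← dest_eq_of_deliver_ne_zero (left_ne_zero_of_mul hp)]
      exact (h.support _ _ _ _ (right_ne_zero_of_mul hp)).2.2
  have h2 : netOut (operated f) i c q = ∑ p, out p q := by
    simp only [out, netOut_eq, operated]
    exact Finset.sum_comm
  have h3 : ∑ p, ∑ r, duplications f i c p q r + out q q = ∑ p, out p q := by
    rw [← Finset.sum_erase_add _ _ (Finset.mem_univ q), ← Finset.sum_erase_add _ (out · q)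
      (Finset.mem_univ q)]
    have : ∑ r, duplications f i c q q r = 0 := Finset.sum_eq_zero fun r _ => by
      simp [duplications]
    rw [this, add_zero]
    congr 1
    refine Finset.sum_congr rfl fun p hp => ?_
    have hp := (Finset.ne_of_mem_erase hp).symm
    simp [duplications, hp, out]
  have h4 : ∑ p, ∑ s, duplications f i c p s q =
      ∑ s ∈ (c.dest \ q).powerset, out (q ∪ s) s := by
    have hd : ∀ p s, duplications f i c p s q ≠ 0 → out p s ≠ 0 ∧ q = p \ s := by
      intro p s hne
      simp only [duplications] at hne
      split_ifs at hne with h'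
      exacts [⟨hne, h'.2⟩, absurd rfl hne]
    rw [Finset.sum_comm]
    symm
    refine Finset.sum_subset_zero_on_sdiff (Finset.subset_univ _) ?_ ?_
    · intro s hs
      refine Finset.sum_eq_zero fun p _ => ?_
      by_contra hne
      obtain ⟨h5, h6⟩ := hd p s hne
      refine (Finset.mem_sdiff.1 hs).2 (Finset.mem_powerset.2 ?_)
      rw [Finset.subset_sdiff]
      refine ⟨(hout _ _ h5).2.1.trans (hout _ _ h5).2.2, ?_⟩
      rw [h6]
      exact Finset.disjoint_sdiff
    · intro s hs
      have hdis : Disjoint q s := Finset.disjoint_sdiff.mono_right (Finset.mem_powerset.1 hs)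
      rw [Finset.sum_eq_single (q ∪ s)]
      · have h5 : q = (q ∪ s) \ s := (Finset.union_sdiff_cancel_right hdis).symm
        have h6 : s ≠ q ∪ s := by
          intro h6
          rw [← h6, Finset.sdiff_self] at h5
          exact hq.ne_empty h5
        exact (if_pos ⟨h6, h5⟩).symm
      · intro p _ hp
        by_contra hne
        obtain ⟨h5, h6⟩ := hd p s hne
        exact hp (by rw [h6, Finset.sdiff_union_of_subset (hout _ _ h5).2.1])
      · simp
  have h5 : rateIn f i c q = _ := rateIn_eq f i c q
  rw [← h1] at h5
  have h6 : ∑ s ∈ (c.dest \ q).powerset, ∑ ι with source ι = i, f ι c (q ∪ s) s =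
      ∑ s ∈ (c.dest \ q).powerset, out (q ∪ s) s := by simp only [out, netOut_eq]
  rw [h6] at h5
  change netIn (operated f) i c q + ((∑ p, ∑ r, duplications f i c p q r) +
    ∑ p, ∑ s, duplications f i c p s q) + out q q = _
  linarith

/-- Operating and duplicating as an efficient flow prescribes balances all queues. -/
theorem IsEfficientFlow.queueBalance {lam : N.ArrivalVector} {f : N.FlowVector}
    (h : IsEfficientFlow lam f) (i : V) (c : N.Chain) :
    QueueBalance i c (fun q => netIn (operated f) i c q + lam i c q +
        copiesIn (duplications f i c) q)
      (fun q => netOut (operated f) i c q + copiesOut (duplications f i c) q) := by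
  intro q hq hqD
  have hO := copiesOut_duplications h i c q
  have hI := netIn_add_copiesIn h i c hq
  refine ⟨fun hc => ?_, fun hc hiq => ?_⟩
  · have := (h.conservation i c q hq hqD).1 hc
    dsimp only at this ⊢
    linarith
  · have hb := (h.conservation i c q hq hqD).2 hc hiq
    have hI' := netIn_add_copiesIn h i c (Finset.insert_nonempty i q)
    have h0 : netOut (operated f) i c (insert i q) = 0 := by
      rw [netOut_eq]
      refine Finset.sum_eq_zero fun ι hι => Finset.sum_eq_zero fun p _ => ?_
      by_contra hne
      refine hne (h.consumed _ _ _ _ hc.1 ?_)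
      rw [(Finset.mem_filter.1 hι).2]
      exact (h.support _ _ _ _ hne).2.2.1 (Finset.mem_insert_self _ _)
    have h1 : 0 ≤ netOut (fun ι c s => f ι c (insert i q) s) i c (insert i q) :=
      netOut_nonneg (fun _ _ _ => h.nonneg _ _ _ _) _ _ _
    dsimp only at hb ⊢
    linarith

variable {lam : N.ArrivalVector} {f : N.FlowVector}

theorem IsEfficientFlow.integral_op (h : IsEfficientFlow lam f) (t : ℕ) (ι : N.Interface)
    (c : N.Chain) (q : Finset V) :
    Integrable (fun ω => operated (choiceDecision t ω) ι c q) h.selection.measure ∧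
    ∫ ω, operated (choiceDecision t ω) ι c q ∂h.selection.measure = operated f ι c q := by
  simp only [operated]
  refine ⟨integrable_finsetSum _ fun p _ => (integral_choiceDecision _ t ι c p q).1, ?_⟩
  rw [integral_finsetSum _ fun p _ => (integral_choiceDecision _ t ι c p q).1]
  refine Finset.sum_congr rfl fun p _ => ?_
  rw [(integral_choiceDecision _ t ι c p q).2, h.fullAmount_mul_selection]

theorem IsEfficientFlow.integral_dup (h : IsEfficientFlow lam f) (t : ℕ) (i : V)
    (c : N.Chain) (q s r : Finset V) :
    Integrable (fun ω => duplications (choiceDecision t ω) i c q s r) h.selection.measure ∧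
    ∫ ω, duplications (choiceDecision t ω) i c q s r ∂h.selection.measure =
      duplications f i c q s r := by
  simp only [duplications]
  split_ifs
  · have hi := fun ι c s => (integral_choiceDecision h.selection t ι c q s).1
    refine ⟨?_, ?_⟩
    · simp only [netOut_eq]
      exact integrable_finsetSum _ fun ι _ => hi ι c s
    · rw [integral_netOut hi]
      congr
      funext ι c s
      rw [(integral_choiceDecision _ t ι c q s).2, h.fullAmount_mul_selection]
  · simp

theorem IsEfficientFlow.hasAvgCost (h : IsEfficientFlow lam f) :
    h.selection.stationaryPolicy.HasAvgCost (cost (operated f)) := by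
  have : ∀ t, ∫ ω, cost (h.selection.stationaryPolicy.op t ω) ∂h.selection.stationaryPolicy.P =
      cost (operated f) := by
    intro t
    refine (integral_cost fun ι c q => (h.integral_op t ι c q).1).trans ?_
    simp only [h.integral_op]
  unfold Policy.HasAvgCost
  simp only [this]
  exact hasLongTermAvg_const _

theorem IsEfficientFlow.isAdmissible (h : IsEfficientFlow lam f) :
    h.selection.stationaryPolicy.IsAdmissible lam where
  op_integrable t ι c q := (h.integral_op t ι c q).1
  dup_integrable t i c q s r := (h.integral_dup t i c q s r).1
  op_nonneg t := ae_of_all _ fun ω ι c q =>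
    Finset.sum_nonneg fun p _ => choiceDecision_nonneg t ω ι c p q
  dup_nonneg t := ae_of_all _ fun ω i c q s r =>
    duplications_nonneg (choiceDecision_nonneg t ω) i c q s r
  op_support t := by
    filter_upwards [ae_selectable h.selection t] with ω hω ι c q hne
    obtain ⟨p, _, hp⟩ := Finset.exists_ne_zero_of_sum_ne_zero hne
    obtain ⟨h1, h2, h3, h4⟩ := hω _ _ _ _ hp
    exact ⟨h1, h2, h3.trans h4⟩
  dup_coverage t := by
    filter_upwards [ae_selectable h.selection t] with ω hω i c q s r hne
    exact duplications_coverage hω hne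
  node_capacity t := ae_of_all _ fun ω i => usage_choiceDecision_le t ω (Sum.inl i)
  link_capacity t := ae_of_all _ fun ω e => usage_choiceDecision_le t ω (Sum.inr e)
  conservation := by
    refine ⟨netIn (operated f), netOut (operated f), fun i c => copiesIn (duplications f i c),
      fun i c => copiesOut (duplications f i c), fun i c q => ?_, fun i c q => ?_,
      fun i c q => ?_, fun i c q => ?_, fun i c k _ hk => ?_, h.queueBalance⟩
    · convert hasLongTermAvg_const (netIn (operated f) i c q) using 2 with t
      refine (integral_netIn (fun ι c q => (h.integral_op t ι c q).1) i c q).trans ?_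
      simp only [h.integral_op]
    · convert hasLongTermAvg_const (netOut (operated f) i c q) using 2 with t
      refine (integral_netOut (fun ι c q => (h.integral_op t ι c q).1) i c q).trans ?_
      simp only [h.integral_op]
    · convert hasLongTermAvg_const (copiesIn (duplications f i c) q) using 2 with t
      refine (integral_copiesIn (fun q s r => (h.integral_dup t i c q s r).1) q).trans ?_
      simp only [h.integral_dup]
    · convert hasLongTermAvg_const (copiesOut (duplications f i c) q) using 2 with t
      refine (integral_copiesOut (fun q s r => (h.integral_dup t i c q s r).1) q).trans ?_
      simp only [h.integral_dup]
    · refine sum_le_sum_of_queueBalance (duplications_nonneg h.nonneg i c)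
        (fun q s r hne => ?_) (netOut_nonneg (fun ι c q => ?_) i c) (h.queueBalance i c) hk
      · exact (duplications_coverage h.support hne).2.2.2.2
      · exact Finset.sum_nonneg fun p _ => h.nonneg _ _ _ _

end Stationary

/-! ### The average flow of a policy -/

section Nominal

variable {V : Type u} {Φ : Type v} [Fintype V] [DecidableEq V] [Fintype Φ] {N : CloudNetwork V Φ}

/-- The conditions on the average amounts `F` of operated and `d` of duplicated packets of an
admissible policy. -/
structure IsNominalFlow (lam : N.ArrivalVector) (F : N.Interface → N.Chain → Finset V → ℝ)
    (d : V → N.Chain → Finset V → Finset V → Finset V → ℝ) : Prop where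
  op_nonneg : ∀ ι c q, 0 ≤ F ι c q
  dup_nonneg : ∀ i c q s r, 0 ≤ d i c q s r
  op_support : ∀ ι c q, F ι c q ≠ 0 → CanOperate ι c ∧ q.Nonempty ∧ q ⊆ c.dest
  dup_coverage : ∀ i c q s r, d i c q s r ≠ 0 →
    q.Nonempty ∧ s.Nonempty ∧ r.Nonempty ∧ q ⊆ c.dest ∧ s ⊆ c.dest ∧ r ⊆ c.dest ∧ q ⊆ s ∪ r
  balance : ∀ i c, QueueBalance i c (fun q => netIn F i c q + lam i c q + copiesIn (d i c) q)
    (fun q => netOut F i c q + copiesOut (d i c) q)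
  usage_le : ∀ ι, usage F ι ≤ capacity ι

/-- The measure on the slots with respect to which integrals are averages over the slots
`1, …, T`. -/
noncomputable def slotMeasure (T : ℕ) : Measure ℕ :=
  ENNReal.ofReal (T : ℝ)⁻¹ • ∑ t ∈ Finset.Icc 1 T, Measure.dirac t

theorem integrable_slotMeasure (T : ℕ) (z : ℕ → ℝ) : Integrable z (slotMeasure T) := by
  refine Integrable.smul_measure ?_ ENNReal.ofReal_ne_top
  rw [integrable_finsetSum_measure]
  exact fun t _ => integrable_dirac (by simp)

theorem integral_slotMeasure (T : ℕ) (z : ℕ → ℝ) :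
    ∫ t, z t ∂slotMeasure T = (T : ℝ)⁻¹ * ∑ t ∈ Finset.Icc 1 T, z t := by
  rw [slotMeasure, integral_smul_measure, integral_finsetSum_measure
    fun t _ => integrable_dirac (by simp), ENNReal.toReal_ofReal (by positivity), smul_eq_mul]
  simp only [integral_dirac]

theorem hasLongTermAvg_iff {z : ℕ → ℝ} {l : ℝ} :
    HasLongTermAvg z l ↔ Tendsto (fun T => ∫ t, z t ∂slotMeasure T) atTop (𝓝 l) := by
  simp only [integral_slotMeasure, HasLongTermAvg]

theorem integral_slotMeasure_nonneg (T : ℕ) {z : ℕ → ℝ} (hz : ∀ t, 0 ≤ z t) :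
    0 ≤ ∫ t, z t ∂slotMeasure T := integral_nonneg hz

theorem integral_slotMeasure_le (T : ℕ) {z : ℕ → ℝ} {B : ℝ} (hB : 0 ≤ B) (hz : ∀ t, z t ≤ B) :
    ∫ t, z t ∂slotMeasure T ≤ B := by
  refine (integral_mono (integrable_slotMeasure T z) (integrable_slotMeasure T fun _ => B)
    hz).trans ?_
  rw [integral_slotMeasure]
  rcases Nat.eq_zero_or_pos T with rfl | hT
  · simpa using hB
  · have : (T : ℝ) ≠ 0 := by positivity
    simp [this]

theorem exists_tendsto_ultrafilter (U : Ultrafilter ℕ) {z : ℕ → ℝ} {B : ℝ}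
    (hz : ∀ᶠ T in (U : Filter ℕ), z T ∈ Set.Icc 0 B) : ∃ x, 0 ≤ x ∧ Tendsto z U (𝓝 x) := by
  obtain ⟨x, hx, h⟩ := isCompact_Icc.ultrafilter_le_nhds (U.map z)
    (le_principal_iff.2 (show ∀ᶠ T in (U : Filter ℕ), z T ∈ Set.Icc 0 B from hz))
  exact ⟨x, hx.1, h⟩

theorem continuous_netIn (i : V) (c : N.Chain) (q : Finset V) :
    Continuous fun F : N.Interface → N.Chain → Finset V → ℝ => netIn F i c q := by
  simp only [netIn_eq]
  fun_prop

omit [Fintype Φ] in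
theorem continuous_netOut (i : V) (c : N.Chain) (q : Finset V) :
    Continuous fun F : N.Interface → N.Chain → Finset V → ℝ => netOut F i c q := by
  simp only [netOut_eq]
  fun_prop

omit [DecidableEq V] in
theorem continuous_usage (ι : N.Interface) :
    Continuous fun F : N.Interface → N.Chain → Finset V → ℝ => usage F ι := by
  simp only [usage_eq]
  fun_prop

omit [DecidableEq V] in
theorem continuous_cost :
    Continuous fun F : N.Interface → N.Chain → Finset V → ℝ => cost F := by
  simp only [cost_eq]
  exact continuous_finsetSum _ fun ι _ => (continuous_usage ι).const_mul _

omit [DecidableEq V] in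
theorem continuous_copiesIn (q : Finset V) :
    Continuous fun d : Finset V → Finset V → Finset V → ℝ => copiesIn d q := by
  unfold copiesIn
  fun_prop

omit [DecidableEq V] in
theorem continuous_copiesOut (q : Finset V) :
    Continuous fun d : Finset V → Finset V → Finset V → ℝ => copiesOut d q := by
  unfold copiesOut
  fun_prop

omit [DecidableEq V] in
theorem le_copiesOut {d : Finset V → Finset V → Finset V → ℝ} (hd : ∀ q s r, 0 ≤ d q s r)
    (q s r : Finset V) : d q s r ≤ copiesOut d q :=
  (Finset.single_le_sum (f := fun r => d q s r) (fun _ _ => hd _ _ _) (Finset.mem_univ r)).trans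
    (Finset.single_le_sum (f := fun s => ∑ r, d q s r)
      (fun _ _ => Finset.sum_nonneg fun _ _ => hd _ _ _) (Finset.mem_univ s))

omit [DecidableEq V] in
theorem mul_le_usage {F : N.Interface → N.Chain → Finset V → ℝ} (hF : ∀ ι c q, 0 ≤ F ι c q)
    (ι : N.Interface) (c : N.Chain) (q : Finset V) : resource ι c * F ι c q ≤ usage F ι := by
  rw [usage_eq]
  refine le_trans (mul_le_mul_of_nonneg_left (Finset.single_le_sum (f := fun q => F ι c q)
    (fun _ _ => hF _ _ _) (Finset.mem_univ q)) (resource_nonneg ι c)) ?_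
  exact Finset.single_le_sum (f := fun c => resource ι c * ∑ q, F ι c q)
    (fun c _ => mul_nonneg (resource_nonneg ι c) (Finset.sum_nonneg fun _ _ => hF _ _ _))
    (Finset.mem_univ c)

/-- The time averages of an admissible policy accumulate at a nominal flow. Only the averages that
occur in the flow conservation law converge; an ultrafilter selects limits for the amounts on the
single interfaces and for the single kinds of duplication. -/
theorem Policy.IsAdmissible.exists_isNominalFlow {π : N.Policy} {lam : N.ArrivalVector}
    (h : π.IsAdmissible lam) :
    ∃ F d, IsNominalFlow lam F d ∧ ∀ κ, π.HasAvgCost κ → cost F = κ := by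
  let U : Ultrafilter ℕ := Ultrafilter.of atTop
  have hU : (U : Filter ℕ) ≤ atTop := Ultrafilter.of_le _
  let E : ℕ → N.Interface → N.Chain → Finset V → ℝ := fun t ι c q => ∫ ω, π.op t ω ι c q ∂π.P
  let G : ℕ → V → N.Chain → Finset V → Finset V → Finset V → ℝ :=
    fun t i c q s r => ∫ ω, π.dup t ω i c q s r ∂π.P
  let EA : ℕ → N.Interface → N.Chain → Finset V → ℝ := fun T ι c q => ∫ t, E t ι c q ∂slotMeasure T
  let GA : ℕ → V → N.Chain → Finset V → Finset V → Finset V → ℝ :=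
    fun T i c q s r => ∫ t, G t i c q s r ∂slotMeasure T
  have hE0 : ∀ t ι c q, 0 ≤ E t ι c q := fun t ι c q => integral_nonneg_of_ae <| by
    filter_upwards [h.op_nonneg t] with ω hω using hω ι c q
  have hG0 : ∀ t i c q s r, 0 ≤ G t i c q s r := fun t i c q s r => integral_nonneg_of_ae <| by
    filter_upwards [h.dup_nonneg t] with ω hω using hω i c q s r
  have hEU : ∀ t ι, usage (E t) ι ≤ capacity ι := by
    intro t ι
    rw [← integral_usage (h.op_integrable t)]
    have : ∀ᵐ ω ∂π.P, usage (π.op t ω) ι ≤ capacity ι := by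
      rcases ι with i | e
      · filter_upwards [h.node_capacity t] with ω hω using hω i
      · filter_upwards [h.link_capacity t] with ω hω using hω e
    refine (integral_mono_ae (integrable_usage (h.op_integrable t) ι)
      (integrable_const (capacity ι)) this).trans ?_
    simp
  have hES : ∀ t ι c q, E t ι c q ≠ 0 → CanOperate ι c ∧ q.Nonempty ∧ q ⊆ c.dest := by
    intro t ι c q hne
    by_contra hcon
    refine hne (integral_eq_zero_of_ae ?_)
    filter_upwards [h.op_support t] with ω hω
    by_contra h'
    exact hcon (hω _ _ _ h')
  have hGS : ∀ t i c q s r, G t i c q s r ≠ 0 → q.Nonempty ∧ s.Nonempty ∧ r.Nonempty ∧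
      q ⊆ c.dest ∧ s ⊆ c.dest ∧ r ⊆ c.dest ∧ q ⊆ s ∪ r := by
    intro t i c q s r hne
    by_contra hcon
    refine hne (integral_eq_zero_of_ae ?_)
    filter_upwards [h.dup_coverage t] with ω hω
    by_contra h'
    exact hcon (hω _ _ _ _ _ h')
  have hEB : ∀ t ι c q, E t ι c q ≤ fullAmount ι c := by
    intro t ι c q
    rcases eq_or_ne (E t ι c q) 0 with h0 | h0
    · rw [h0]; exact fullAmount_nonneg _ _
    · have hr := resource_pos (hES t ι c q h0).1
      rw [fullAmount_eq, le_div_iff₀ hr, mul_comm]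
      exact (mul_le_usage (hE0 t) ι c q).trans (hEU t ι)
  have hGA0 : ∀ T i c q s r, 0 ≤ GA T i c q s r :=
    fun T i c q s r => integral_slotMeasure_nonneg T fun t => hG0 t i c q s r
  obtain ⟨fIn, fOut, dIn, dOut, hfIn, hfOut, hdIn, hdOut, -, hbal⟩ := h.conservation
  -- the averages over the slots and over the sample space are moved into the linear expressions
  have hfIn' : ∀ i c q, Tendsto (fun T => netIn (EA T) i c q) U (𝓝 (fIn i c q)) := by
    intro i c q
    refine ((hasLongTermAvg_iff.1 (hfIn i c q)).mono_left hU).congr fun T => ?_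
    simp only [integral_netIn (h.op_integrable _)]
    exact integral_netIn (fun ι c q => integrable_slotMeasure T fun t => E t ι c q) i c q
  have hfOut' : ∀ i c q, Tendsto (fun T => netOut (EA T) i c q) U (𝓝 (fOut i c q)) := by
    intro i c q
    refine ((hasLongTermAvg_iff.1 (hfOut i c q)).mono_left hU).congr fun T => ?_
    simp only [integral_netOut (h.op_integrable _)]
    exact integral_netOut (fun ι c q => integrable_slotMeasure T fun t => E t ι c q) i c q
  have hdIn' : ∀ i c q, Tendsto (fun T => copiesIn (GA T i c) q) U (𝓝 (dIn i c q)) := by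
    intro i c q
    refine ((hasLongTermAvg_iff.1 (hdIn i c q)).mono_left hU).congr fun T => ?_
    simp only [integral_copiesIn (h.dup_integrable _ i c)]
    exact integral_copiesIn (fun q s r => integrable_slotMeasure T fun t => G t i c q s r) q
  have hdOut' : ∀ i c q, Tendsto (fun T => copiesOut (GA T i c) q) U (𝓝 (dOut i c q)) := by
    intro i c q
    refine ((hasLongTermAvg_iff.1 (hdOut i c q)).mono_left hU).congr fun T => ?_
    simp only [integral_copiesOut (h.dup_integrable _ i c)]
    exact integral_copiesOut (fun q s r => integrable_slotMeasure T fun t => G t i c q s r) q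
  have hF : ∀ ι c q, ∃ x, 0 ≤ x ∧ Tendsto (fun T => EA T ι c q) U (𝓝 x) := fun ι c q =>
    exists_tendsto_ultrafilter U (B := fullAmount ι c) <| Eventually.of_forall fun T =>
      ⟨integral_slotMeasure_nonneg T fun t => hE0 t ι c q,
        integral_slotMeasure_le T (fullAmount_nonneg ι c) fun t => hEB t ι c q⟩
  have hd : ∀ i c q s r, ∃ x, 0 ≤ x ∧ Tendsto (fun T => GA T i c q s r) U (𝓝 x) := by
    intro i c q s r
    refine exists_tendsto_ultrafilter U (B := dOut i c q + 1) ?_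
    filter_upwards [(hdOut' i c q).eventually_le_const (lt_add_one _)] with T hT
    exact ⟨hGA0 T i c q s r, (le_copiesOut (hGA0 T i c) q s r).trans hT⟩
  choose F hF0 hF using hF
  choose d hd0 hd using hd
  have hF' : Tendsto EA U (𝓝 F) := by
    simp only [tendsto_pi_nhds]
    exact hF
  have hd' : ∀ i c, Tendsto (fun T => GA T i c) U (𝓝 (d i c)) := by
    simp only [tendsto_pi_nhds]
    exact hd
  refine ⟨F, d, ⟨hF0, hd0, fun ι c q hne => ?_, fun i c q s r hne => ?_, fun i c => ?_,
    fun ι => ?_⟩, fun κ hκ => ?_⟩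
  · by_contra hcon
    refine hne (tendsto_nhds_unique (hF ι c q) ?_)
    have : ∀ T, EA T ι c q = 0 := fun T => integral_eq_zero_of_ae <| ae_of_all _ fun t => by
      by_contra h'
      exact hcon (hES t ι c q h')
    simp only [this]
    exact tendsto_const_nhds
  · by_contra hcon
    refine hne (tendsto_nhds_unique (hd i c q s r) ?_)
    have : ∀ T, GA T i c q s r = 0 := fun T => integral_eq_zero_of_ae <| ae_of_all _ fun t => by
      by_contra h'
      exact hcon (hGS t i c q s r h')
    simp only [this]
    exact tendsto_const_nhds
  · have h1 : ∀ q, netIn F i c q = fIn i c q := fun q =>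
      tendsto_nhds_unique (((continuous_netIn i c q).tendsto F).comp hF') (hfIn' i c q)
    have h2 : ∀ q, netOut F i c q = fOut i c q := fun q =>
      tendsto_nhds_unique (((continuous_netOut i c q).tendsto F).comp hF') (hfOut' i c q)
    have h3 : ∀ q, copiesIn (d i c) q = dIn i c q := fun q =>
      tendsto_nhds_unique (((continuous_copiesIn q).tendsto _).comp (hd' i c)) (hdIn' i c q)
    have h4 : ∀ q, copiesOut (d i c) q = dOut i c q := fun q =>
      tendsto_nhds_unique (((continuous_copiesOut q).tendsto _).comp (hd' i c)) (hdOut' i c q)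
    simp only [h1, h2, h3, h4]
    exact hbal i c
  · refine le_of_tendsto (((continuous_usage ι).tendsto F).comp hF')
      (Eventually.of_forall fun T => ?_)
    change usage (EA T) ι ≤ _
    rw [← integral_usage (fun ι c q => integrable_slotMeasure T fun t => E t ι c q)]
    exact integral_slotMeasure_le T (capacity_nonneg ι) fun t => hEU t ι
  · refine tendsto_nhds_unique ((continuous_cost.tendsto F).comp hF')
      (((hasLongTermAvg_iff.1 hκ).mono_left hU).congr fun T => ?_)
    simp only [integral_cost (h.op_integrable _)]
    exact integral_cost (fun ι c q => integrable_slotMeasure T fun t => E t ι c q)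

end Nominal

/-! ### Expected visits of a branching process -/

section Occupation

/-- A branching process on the states `S` starts with `μ` and replaces an individual in state `x` by
`K x y` individuals in the states `y`. An individual carries `cnt x r` particles of each type `r`,
of which one of type `top x` is used up in the next step, while `P (top x) r` new ones of type `r`
are made. If the particle numbers admit the supersolution `out` of the equations for the total
numbers, then the expected numbers of visits are finite and no more than `out r` particles of
type `r` are used. -/
theorem exists_occupation {S R : Type*} [Fintype S] [Fintype R] [DecidableEq R] {μ : S → ℝ}
    {K : S → S → ℝ} {Valid : S → Prop} {top : S → R} {cnt : S → R → ℝ} {out : R → ℝ}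
    {P : R → R → ℝ} (hμ : ∀ x, 0 ≤ μ x) (hK : ∀ x y, 0 ≤ K x y) (hP : ∀ r r', 0 ≤ P r r')
    (hμV : ∀ x, ¬ Valid x → μ x = 0) (hKV : ∀ x y, ¬ Valid y → K x y = 0)
    (hcnt : ∀ x r, Valid x → (if top x = r then (1 : ℝ) else 0) ≤ cnt x r)
    (hstep : ∀ x r, Valid x → ∑ y, K x y * cnt y r + (if top x = r then (1 : ℝ) else 0) ≤
      cnt x r + P (top x) r)
    (hout0 : ∀ r, 0 ≤ out r)
    (hout : ∀ r, ∑ x, μ x * cnt x r + ∑ r', out r' * P r' r ≤ out r) :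
    ∃ X : S → ℝ, (∀ x, 0 ≤ X x) ∧ (∀ x, ¬ Valid x → X x = 0) ∧
      (∀ y, X y = μ y + ∑ x, X x * K x y) ∧ ∀ r, ∑ x with top x = r, X x ≤ out r := by
  let m : ℕ → S → ℝ := fun t => Nat.rec μ (fun _ g y => ∑ x, g x * K x y) t
  have hm : ∀ t y, m (t + 1) y = ∑ x, m t x * K x y := fun t y => rfl
  have hm0 : ∀ t y, 0 ≤ m t y := by
    intro t
    induction t with
    | zero => exact hμ
    | succ t ih => exact fun y => Finset.sum_nonneg fun x _ => mul_nonneg (ih x) (hK x y)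
  have hmV : ∀ t y, ¬ Valid y → m t y = 0 := by
    intro t y hy
    cases t with
    | zero => exact hμV y hy
    | succ t => exact Finset.sum_eq_zero fun x _ => by rw [hKV x y hy, mul_zero]
  let A : ℕ → S → ℝ := fun T y => ∑ t ∈ Finset.range T, m t y
  have hA : ∀ T y, A (T + 1) y = A T y + m T y := fun T y => Finset.sum_range_succ _ _
  have hA' : ∀ T y, A (T + 1) y = μ y + ∑ x, A T x * K x y := by
    intro T y
    simp only [A, Finset.sum_range_succ', hm, Finset.sum_mul]
    rw [Finset.sum_comm, add_comm]
    rfl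
  let used : ℕ → R → ℝ := fun T r => ∑ x, A T x * if top x = r then 1 else 0
  have hused : ∀ T r, used (T + 1) r = used T r + ∑ x, m T x * if top x = r then 1 else 0 := by
    intro T r
    simp only [used, hA, add_mul, Finset.sum_add_distrib]
  have hPtop : ∀ T r, ∑ r', (∑ x, m T x * if top x = r' then (1 : ℝ) else 0) * P r' r =
      ∑ x, m T x * P (top x) r := by
    intro T r
    simp only [Finset.sum_mul]
    rw [Finset.sum_comm]
    refine Finset.sum_congr rfl fun x _ => ?_
    simp
  -- particles used so far and particles present never exceed the particles made so far
  have hinv : ∀ T r, used T r + ∑ x, m T x * cnt x r ≤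
      ∑ x, μ x * cnt x r + ∑ r', used T r' * P r' r := by
    intro T r
    induction T with
    | zero => simp [used, A, m]
    | succ T ih =>
      have h1 : ∑ y, m (T + 1) y * cnt y r + ∑ x, m T x * (if top x = r then 1 else 0) ≤
          ∑ x, m T x * cnt x r + ∑ x, m T x * P (top x) r := by
        simp only [hm, Finset.sum_mul]
        rw [Finset.sum_comm, ← Finset.sum_add_distrib, ← Finset.sum_add_distrib]
        refine Finset.sum_le_sum fun x _ => ?_
        by_cases hx : Valid x
        · simp only [mul_assoc]
          rw [← Finset.mul_sum, ← mul_add, ← mul_add]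
          exact mul_le_mul_of_nonneg_left (hstep x r hx) (hm0 T x)
        · simp [hmV T x hx]
      have h2 : ∑ r', used (T + 1) r' * P r' r =
          ∑ r', used T r' * P r' r + ∑ x, m T x * P (top x) r := by
        simp only [hused, add_mul, Finset.sum_add_distrib, hPtop]
      rw [h2, hused]
      linarith
  have hle : ∀ T r, used T r ≤ out r := by
    intro T
    induction T with
    | zero => intro r; simpa [used, A] using hout0 r
    | succ T ih =>
      intro r
      have h1 : ∑ x, m T x * (if top x = r then 1 else 0) ≤ ∑ x, m T x * cnt x r := by
        refine Finset.sum_le_sum fun x _ => ?_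
        by_cases hx : Valid x
        · exact mul_le_mul_of_nonneg_left (hcnt x r hx) (hm0 T x)
        · simp [hmV T x hx]
      have h2 : ∑ r', used T r' * P r' r ≤ ∑ r', out r' * P r' r :=
        Finset.sum_le_sum fun r' _ => mul_le_mul_of_nonneg_right (ih r') (hP r' r)
      rw [hused]
      linarith [hinv T r, hout r]
  have hA0 : ∀ T y, 0 ≤ A T y := fun T y => Finset.sum_nonneg fun t _ => hm0 t y
  have hmono : ∀ y, Monotone fun T => A T y := fun y => monotone_nat_of_le_succ fun T => by
    rw [hA]; exact le_add_of_nonneg_right (hm0 T y)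
  have hbdd : ∀ y, BddAbove (Set.range fun T => A T y) := by
    rintro y
    refine ⟨out (top y), ?_⟩
    rintro _ ⟨T, rfl⟩
    refine le_trans ?_ (hle T (top y))
    refine le_trans (by simp) (Finset.single_le_sum
      (f := fun x => A T x * if top x = top y then 1 else 0) (fun x _ => ?_) (Finset.mem_univ y))
    exact mul_nonneg (hA0 T x) (by split_ifs <;> simp)
  have hlim : ∀ y, Tendsto (fun T => A T y) atTop (𝓝 (⨆ T, A T y)) := fun y =>
    tendsto_atTop_ciSup (hmono y) (hbdd y)
  refine ⟨fun y => ⨆ T, A T y, fun y => ge_of_tendsto' (hlim y) fun T => hA0 T y,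
    fun y hy => ?_, fun y => ?_, fun r => ?_⟩
  · refine tendsto_nhds_unique (hlim y) ?_
    have : ∀ T, A T y = 0 := fun T => Finset.sum_eq_zero fun t _ => hmV t y hy
    simp only [this]
    exact tendsto_const_nhds
  · refine tendsto_nhds_unique ((tendsto_add_atTop_iff_nat 1).2 (hlim y)) ?_
    simp only [hA']
    exact tendsto_const_nhds.add (tendsto_finsetSum _ fun x _ => (hlim x).mul_const _)
  · refine le_of_tendsto' (tendsto_finsetSum _ fun x _ => hlim x) fun T => ?_
    refine le_trans (le_of_eq ?_) (hle T r)
    simp [used, Finset.sum_filter]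

end Occupation

/-! ### Consumption at the destinations -/

section Consumption

variable {V : Type u} {Φ : Type v} [DecidableEq V] {N : CloudNetwork V Φ}

/-- The status with which a packet of `(c, q)` continues when it has reached node `i`. -/
noncomputable def consume (i : V) (c : N.Chain) (q : Finset V) : Finset V :=
  if c.IsFinal then q.erase i else q

theorem mem_consume {i : V} {c : N.Chain} {q : Finset V} {k : V} :
    k ∈ consume i c q ↔ k ∈ q ∧ ¬ (c.IsFinal ∧ k = i) := by
  unfold consume
  split_ifs with h <;> simp [h, and_comm]

theorem consume_subset (i : V) (c : N.Chain) (q : Finset V) : consume i c q ⊆ q :=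
  fun _ hk => (mem_consume.1 hk).1

theorem consume_consume (i : V) (c : N.Chain) (q : Finset V) :
    consume i c (consume i c q) = consume i c q := by
  ext k
  simp only [mem_consume]
  tauto

theorem consume_mono (i : V) (c : N.Chain) {q q' : Finset V} (h : q ⊆ q') :
    consume i c q ⊆ consume i c q' := fun _ hk =>
  mem_consume.2 ⟨h (mem_consume.1 hk).1, (mem_consume.1 hk).2⟩

/-- Indicator of the packets of status `p` that continue with the nonempty status `m` when they have
reached node `i`. -/
noncomputable def becomes (i : V) (c : N.Chain) (p m : Finset V) : ℝ :=
  if p ⊆ c.dest ∧ consume i c p = m ∧ m ≠ ∅ then 1 else 0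

theorem becomes_nonneg (i : V) (c : N.Chain) (p m : Finset V) : 0 ≤ becomes i c p m := by
  unfold becomes
  split_ifs <;> simp

theorem sum_becomes [Fintype V] {i : V} {c : N.Chain} {m : Finset V} (hm : m.Nonempty)
    (hmD : m ⊆ c.dest) (hmc : consume i c m = m) (g : Finset V → ℝ) :
    ∑ p, becomes i c p m * g p =
      g m + if c.IsFinal ∧ i ∈ c.dest then g (insert i m) else 0 := by
  have him : c.IsFinal → i ∉ m := fun hc hi => by
    rw [← hmc, mem_consume] at hi
    exact hi.2 ⟨hc, rfl⟩
  have key : ∀ p, becomes i c p m = (if p = m then 1 else 0) +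
      if (c.IsFinal ∧ i ∈ c.dest) ∧ p = insert i m then 1 else 0 := by
    intro p
    by_cases h1 : p = m
    · subst h1
      have h2 : ¬ ((c.IsFinal ∧ i ∈ c.dest) ∧ p = insert i p) := fun h =>
        him h.1.1 (h.2 ▸ Finset.mem_insert_self i p)
      rw [becomes, if_pos ⟨hmD, hmc, hm.ne_empty⟩, if_pos rfl, if_neg h2, add_zero]
    · rw [if_neg h1, zero_add]
      by_cases h2 : (c.IsFinal ∧ i ∈ c.dest) ∧ p = insert i m
      · rw [if_pos h2]
        obtain ⟨⟨h3, h4⟩, rfl⟩ := h2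
        refine if_pos ⟨Finset.insert_subset h4 hmD, ?_, hm.ne_empty⟩
        rw [consume, if_pos h3, Finset.erase_insert (him h3)]
      · rw [if_neg h2]
        refine if_neg fun h => h2 ?_
        obtain ⟨h3, h4, -⟩ := h
        by_cases hc : c.IsFinal
        · rw [consume, if_pos hc] at h4
          have hip : i ∈ p := by
            by_contra hip
            rw [Finset.erase_eq_of_notMem hip] at h4
            exact h1 h4
          exact ⟨⟨hc, h3 hip⟩, by rw [← h4, Finset.insert_erase hip]⟩
        · rw [consume, if_neg hc] at h4
          exact absurd h4 h1
  simp only [key, add_mul, Finset.sum_add_distrib]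
  congr 1
  · simp
  · by_cases h : c.IsFinal ∧ i ∈ c.dest
    · simp [h]
    · simp only [h, false_and, if_false, zero_mul, Finset.sum_const_zero]

/-- The two cases of the balance of the queues in one inequality. -/
theorem QueueBalance.sum_becomes_le [Fintype V] {i : V} {c : N.Chain}
    {input output : Finset V → ℝ} (h : QueueBalance i c input output) (hout : ∀ q, 0 ≤ output q)
    (m : Finset V) : ∑ p, becomes i c p m * input p ≤ output m := by
  by_cases hm : ∃ p, p ⊆ c.dest ∧ consume i c p = m ∧ m ≠ ∅
  · obtain ⟨p, hp, rfl, hm⟩ := hm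
    have hm := Finset.nonempty_iff_ne_empty.2 hm
    have hmD := (consume_subset i c p).trans hp
    rw [sum_becomes hm hmD (consume_consume i c p)]
    split_ifs with hc
    · refine (h _ hm hmD).2 hc fun hi => ?_
      exact (mem_consume.1 hi).2 ⟨hc.1, rfl⟩
    · rw [add_zero]
      exact (h _ hm hmD).1 hc
  · refine (Finset.sum_eq_zero fun p _ => ?_).trans_le (hout m)
    rw [becomes, if_neg fun h' => hm ⟨p, h'⟩, zero_mul]

end Consumption

/-! ### Packets with an assignment of their destinations to the copies of a policy -/

section Assignment

variable {V : Type u}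

/-- The assignment of all destinations in `t` to one copy of status `n`. An assignment `τ` gives
for every destination `k` that is still to be served the status `τ k` of the copy that serves it;
`τ k = ∅` says that `k` need not be served. -/
noncomputable def assignAll (n t : Finset V) : V → Finset V := fun k => if k ∈ t then n else ∅

/-- The assignment left when the copy of status `n` has been sent. -/
noncomputable def dropCopy (τ : V → Finset V) (n : Finset V) : V → Finset V :=
  fun k => if τ k = n then ∅ else τ k

/-- The assignment that results from the replacement of the copy of status `n` by copies of status
`s` and `r`; the destinations in both `s` and `r` are left to the first of them. -/
noncomputable def splitCopy (τ : V → Finset V) (n s r : Finset V) : V → Finset V :=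
  fun k => if τ k = n then (if k ∈ s then s else r) else τ k

variable [Fintype V]

/-- The destinations that are still to be served. -/
noncomputable def active (τ : V → Finset V) : Finset V := Finset.univ.filter fun k => τ k ≠ ∅

/-- The destinations that the copy of status `n` has to serve. -/
noncomputable def served (τ : V → Finset V) (n : Finset V) : Finset V :=
  Finset.univ.filter fun k => τ k = n

/-- The copy that is operated or duplicated next, an arbitrary one. -/
noncomputable def topCopy (τ : V → Finset V) : Finset V :=
  if h : (active τ).Nonempty then τ h.choose else ∅

theorem mem_active {τ : V → Finset V} {k : V} : k ∈ active τ ↔ τ k ≠ ∅ := by simp [active]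

theorem mem_served {τ : V → Finset V} {n : Finset V} {k : V} : k ∈ served τ n ↔ τ k = n := by
  simp [served]

theorem exists_eq_topCopy {τ : V → Finset V} (h : (active τ).Nonempty) :
    ∃ k, τ k = topCopy τ ∧ topCopy τ ≠ ∅ := by
  refine ⟨h.choose, ?_, ?_⟩
  · rw [topCopy, dif_pos h]
  · rw [topCopy, dif_pos h]
    exact mem_active.1 h.choose_spec

theorem served_subset_active {τ : V → Finset V} {n : Finset V} (hn : n ≠ ∅) :
    served τ n ⊆ active τ := fun k hk => mem_active.2 (by rwa [mem_served.1 hk])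

theorem active_assignAll {n t : Finset V} (hn : n ≠ ∅) : active (assignAll n t) = t := by
  ext k
  simp [mem_active, assignAll, hn]

theorem active_assignAll_of_subset {n t : Finset V} (h : t ⊆ n) : active (assignAll n t) = t := by
  rcases eq_or_ne n ∅ with rfl | hn
  · rw [Finset.subset_empty.1 h]
    ext k
    simp [mem_active, assignAll]
  · exact active_assignAll hn

theorem active_dropCopy [DecidableEq V] (τ : V → Finset V) (n : Finset V) :
    active (dropCopy τ n) = active τ \ served τ n := by
  ext k
  by_cases h : τ k = n <;> simp [mem_active, mem_served, dropCopy, h]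

theorem active_splitCopy {τ : V → Finset V} {n s r : Finset V} (hn : n ≠ ∅)
    (h : ∀ k, τ k = n → k ∈ s ∨ k ∈ r) : active (splitCopy τ n s r) = active τ := by
  ext k
  rw [mem_active, mem_active, splitCopy]
  by_cases hk : τ k = n
  · rw [if_pos hk, hk]
    refine iff_of_true ?_ hn
    split_ifs with hs
    · exact Finset.ne_empty_of_mem hs
    · exact Finset.ne_empty_of_mem ((h k hk).resolve_left hs)
  · rw [if_neg hk]

end Assignment

/-! ### The branching process that serves every destination once -/

section Emulation

variable {V : Type u} {Φ : Type v} [Fintype V] [DecidableEq V] [Fintype Φ] {N : CloudNetwork V Φ}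

variable (N) in
/-- A packet of the emulating policy: its node, its service, stage and destination set, and the
assignment of its current destinations to copies of the emulated policy. -/
abbrev Packet : Type (max u v) := V × N.Chain × (V → Finset V)

variable (N) in
/-- A queue `(i, c, q)` of the emulated policy. -/
abbrev Queue : Type (max u v) := V × N.Chain × Finset V

/-- The queue of the copy that is operated or duplicated next. -/
noncomputable def Packet.top (x : N.Packet) : N.Queue := (x.1, x.2.1, topCopy x.2.2)

/-- The packet is not yet delivered, and each of its destinations belongs to the status of the copy
to which it is assigned. -/
def Packet.IsValid (x : N.Packet) : Prop :=
  (active x.2.2).Nonempty ∧ ∀ k, x.2.2 k ≠ ∅ →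
    k ∈ x.2.2 k ∧ x.2.2 k ⊆ x.2.1.dest ∧ consume x.1 x.2.1 (x.2.2 k) = x.2.2 k

/-- Total rate out of a queue. -/
def outRate (F : N.Interface → N.Chain → Finset V → ℝ)
    (d : V → N.Chain → Finset V → Finset V → Finset V → ℝ) (r : N.Queue) : ℝ :=
  netOut F r.1 r.2.1 r.2.2 + copiesOut (d r.1 r.2.1) r.2.2

/-- The sum of `φ` over the packets by which the packet `x` is replaced in one step, multiplied by
the rate out of the queue of its next copy. Each interface and each kind of duplication that this
queue uses is chosen with a probability proportional to its rate. When the copy is operated, the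
rest of the packet is kept, and the destinations that the copy serves travel with it. -/
noncomputable def successors (F : N.Interface → N.Chain → Finset V → ℝ)
    (d : V → N.Chain → Finset V → Finset V → Finset V → ℝ) (x : N.Packet) :
    (N.Packet → ℝ) →ₗ[ℝ] ℝ :=
  (∑ ι with source ι = x.1, F ι x.2.1 (topCopy x.2.2) •
    (LinearMap.proj (x.1, x.2.1, dropCopy x.2.2 (topCopy x.2.2)) +
      ∑ j, ∑ c', deliver ι x.2.1 j c' • LinearMap.proj (j, c',
        assignAll (consume j c' (topCopy x.2.2)) (consume j c' (served x.2.2 (topCopy x.2.2)))))) +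
  ∑ s, ∑ r, d x.1 x.2.1 (topCopy x.2.2) s r •
    LinearMap.proj (x.1, x.2.1,
      splitCopy x.2.2 (topCopy x.2.2) (consume x.1 x.2.1 s) (consume x.1 x.2.1 r))

theorem successors_apply (F : N.Interface → N.Chain → Finset V → ℝ)
    (d : V → N.Chain → Finset V → Finset V → Finset V → ℝ) (x : N.Packet) (φ : N.Packet → ℝ) :
    successors F d x φ =
      (∑ ι with source ι = x.1, F ι x.2.1 (topCopy x.2.2) *
        (φ (x.1, x.2.1, dropCopy x.2.2 (topCopy x.2.2)) +
          ∑ j, ∑ c', deliver ι x.2.1 j c' * φ (j, c', assignAll (consume j c' (topCopy x.2.2))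
            (consume j c' (served x.2.2 (topCopy x.2.2)))))) +
      ∑ s, ∑ r, d x.1 x.2.1 (topCopy x.2.2) s r * φ (x.1, x.2.1,
        splitCopy x.2.2 (topCopy x.2.2) (consume x.1 x.2.1 s) (consume x.1 x.2.1 r)) := by
  simp [successors, mul_add]

/-- The expected number of valid packets `y` by which the packet `x` is replaced in one step. -/
noncomputable def kernel (F : N.Interface → N.Chain → Finset V → ℝ)
    (d : V → N.Chain → Finset V → Finset V → Finset V → ℝ) (x y : N.Packet) : ℝ :=
  if y.IsValid then successors F d x (fun z => if y = z then 1 else 0) / outRate F d x.top else 0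

/-- The rate of valid packets that arrive from outside the network, all their destinations being
assigned to one copy. -/
noncomputable def arrivals (lam : N.ArrivalVector) (y : N.Packet) : ℝ :=
  if y.IsValid then ∑ p, if p ⊆ y.2.1.dest ∧
    assignAll (consume y.1 y.2.1 p) (consume y.1 y.2.1 p) = y.2.2 then lam y.1 y.2.1 p else 0
  else 0

/-- Indicator of the valid packets that have a copy in the queue `r`. -/
noncomputable def hasCopy (y : N.Packet) (r : N.Queue) : ℝ :=
  if y.IsValid ∧ y.1 = r.1 ∧ y.2.1 = r.2.1 ∧ r.2.2 ≠ ∅ ∧ ∃ k, y.2.2 k = r.2.2 then 1 else 0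

/-- The rate at which the packets that leave the queue `r'` make new packets in the queue `r`. -/
noncomputable def transfer (F : N.Interface → N.Chain → Finset V → ℝ)
    (d : V → N.Chain → Finset V → Finset V → Finset V → ℝ) (r' r : N.Queue) : ℝ :=
  (∑ ι with source ι = r'.1, F ι r'.2.1 r'.2.2 *
    (deliver ι r'.2.1 r.1 r.2.1 * becomes r.1 r.2.1 r'.2.2 r.2.2)) +
  ∑ s, ∑ t, d r'.1 r'.2.1 r'.2.2 s t * if r'.1 = r.1 ∧ r'.2.1 = r.2.1 then
    becomes r.1 r.2.1 s r.2.2 + becomes r.1 r.2.1 t r.2.2 else 0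

variable {lam : N.ArrivalVector} {F : N.Interface → N.Chain → Finset V → ℝ}
  {d : V → N.Chain → Finset V → Finset V → Finset V → ℝ}

theorem sum_kernel_mul (x : N.Packet) (φ : N.Packet → ℝ) :
    ∑ y, kernel F d x y * φ y =
      successors F d x (fun y => if y.IsValid then φ y else 0) / outRate F d x.top := by
  rw [LinearMap.pi_apply_eq_sum_univ (successors F d x), Finset.sum_div]
  refine Finset.sum_congr rfl fun y _ => ?_
  rw [kernel, smul_eq_mul]
  split_ifs
  · rw [mul_comm, mul_div_assoc]
    congr!
  · simp

theorem sum_arrivals_mul (φ : N.Packet → ℝ) :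
    ∑ y, arrivals lam y * φ y = ∑ i, ∑ c, ∑ p, if p ⊆ c.dest then
      lam i c p * (if Packet.IsValid (N := N) (i, c, assignAll (consume i c p) (consume i c p))
        then φ (i, c, assignAll (consume i c p) (consume i c p)) else 0) else 0 := by
  rw [Fintype.sum_prod_type]
  refine Finset.sum_congr rfl fun i _ => ?_
  rw [Fintype.sum_prod_type]
  refine Finset.sum_congr rfl fun c _ => ?_
  have : ∀ τ : V → Finset V, arrivals lam (i, c, τ) * φ (i, c, τ) = ∑ p,
      if assignAll (consume i c p) (consume i c p) = τ then (if p ⊆ c.dest then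
        lam i c p * (if Packet.IsValid (N := N) (i, c, τ) then φ (i, c, τ) else 0) else 0)
      else 0 := by
    intro τ
    simp only [arrivals]
    split_ifs with h
    · rw [Finset.sum_mul]
      refine Finset.sum_congr rfl fun p _ => ?_
      by_cases h1 : p ⊆ c.dest <;> by_cases h2 : assignAll (consume i c p) (consume i c p) = τ <;>
        simp [h1, h2]
    · simp
  simp only [this]
  rw [Finset.sum_comm]
  refine Finset.sum_congr rfl fun p _ => ?_
  simp

end Emulation

section Validity

variable {V : Type u} {Φ : Type v} [Fintype V] [DecidableEq V] {N : CloudNetwork V Φ}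
variable {x : N.Packet}

theorem Packet.IsValid.exists_eq_topCopy (hx : x.IsValid) :
    ∃ k, x.2.2 k = topCopy x.2.2 ∧ topCopy x.2.2 ≠ ∅ :=
  CloudNetwork.exists_eq_topCopy hx.1

theorem Packet.IsValid.topCopy_ne_empty (hx : x.IsValid) : topCopy x.2.2 ≠ ∅ :=
  hx.exists_eq_topCopy.choose_spec.2

theorem Packet.IsValid.mem_topCopy (hx : x.IsValid) {k : V} (hk : x.2.2 k = topCopy x.2.2) :
    k ∈ topCopy x.2.2 := hk ▸ (hx.2 k (hk ▸ hx.topCopy_ne_empty)).1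

theorem Packet.IsValid.topCopy_spec (hx : x.IsValid) :
    topCopy x.2.2 ⊆ x.2.1.dest ∧ consume x.1 x.2.1 (topCopy x.2.2) = topCopy x.2.2 := by
  obtain ⟨k, hk, hne⟩ := hx.exists_eq_topCopy
  have := hx.2 k (by rwa [hk])
  rw [hk] at this
  exact this.2

theorem Packet.IsValid.served_subset (hx : x.IsValid) :
    served x.2.2 (topCopy x.2.2) ⊆ topCopy x.2.2 :=
  fun _ hk => hx.mem_topCopy (mem_served.1 hk)

theorem Packet.IsValid.served_subset_active (hx : x.IsValid) :
    served x.2.2 (topCopy x.2.2) ⊆ active x.2.2 :=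
  CloudNetwork.served_subset_active hx.topCopy_ne_empty

theorem Packet.IsValid.served_nonempty (hx : x.IsValid) :
    (served x.2.2 (topCopy x.2.2)).Nonempty := by
  obtain ⟨k, hk, -⟩ := hx.exists_eq_topCopy
  exact ⟨k, mem_served.2 hk⟩

theorem Packet.IsValid.active_subset (hx : x.IsValid) : active x.2.2 ⊆ x.2.1.dest :=
  fun k hk => (hx.2 k (mem_active.1 hk)).2.1 (hx.2 k (mem_active.1 hk)).1

theorem Packet.IsValid.notMem_active (hx : x.IsValid) (hc : x.2.1.IsFinal) :
    x.1 ∉ active x.2.2 := by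
  intro hk
  obtain ⟨h1, -, h3⟩ := hx.2 _ (mem_active.1 hk)
  rw [← h3, mem_consume] at h1
  exact h1.2 ⟨hc, rfl⟩

theorem Packet.IsValid.dropCopy (hx : x.IsValid)
    (h : (active (dropCopy x.2.2 (topCopy x.2.2))).Nonempty) :
    Packet.IsValid (N := N) (x.1, x.2.1, CloudNetwork.dropCopy x.2.2 (topCopy x.2.2)) := by
  refine ⟨h, fun k hk => ?_⟩
  simp only [CloudNetwork.dropCopy] at hk ⊢
  split_ifs at hk ⊢
  · exact absurd rfl hk
  · exact hx.2 k hk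

theorem isValid_assignAll {j : V} {c : N.Chain} {n t : Finset V} (ht : t ⊆ n) (hn : n ⊆ c.dest)
    (h : (consume j c t).Nonempty) :
    Packet.IsValid (N := N) (j, c, assignAll (consume j c n) (consume j c t)) := by
  refine ⟨?_, fun k hk => ?_⟩
  · dsimp only
    rwa [active_assignAll_of_subset (consume_mono j c ht)]
  · have hkt : k ∈ consume j c t := by
      by_contra hkt
      exact hk (if_neg hkt)
    simp only [assignAll, if_pos hkt]
    exact ⟨consume_mono j c ht hkt, (consume_subset j c n).trans hn, consume_consume j c n⟩

theorem Packet.IsValid.mem_copies (hx : x.IsValid) {s r : Finset V}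
    (hcov : topCopy x.2.2 ⊆ s ∪ r) {k : V} (hk : x.2.2 k = topCopy x.2.2) :
    k ∈ consume x.1 x.2.1 s ∨ k ∈ consume x.1 x.2.1 r := by
  have h1 := hx.mem_topCopy hk
  have h2 := h1
  rw [← hx.topCopy_spec.2, mem_consume] at h2
  rw [mem_consume, mem_consume]
  rcases Finset.mem_union.1 (hcov h1) with h | h
  exacts [Or.inl ⟨h, h2.2⟩, Or.inr ⟨h, h2.2⟩]

theorem Packet.IsValid.active_splitCopy (hx : x.IsValid) {s r : Finset V}
    (hcov : topCopy x.2.2 ⊆ s ∪ r) :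
    active (splitCopy x.2.2 (topCopy x.2.2) (consume x.1 x.2.1 s) (consume x.1 x.2.1 r)) =
      active x.2.2 :=
  CloudNetwork.active_splitCopy hx.topCopy_ne_empty fun _ hk => hx.mem_copies hcov hk

theorem Packet.IsValid.splitCopy (hx : x.IsValid) {s r : Finset V}
    (hs : s ⊆ x.2.1.dest) (hr : r ⊆ x.2.1.dest) (hcov : topCopy x.2.2 ⊆ s ∪ r) :
    Packet.IsValid (N := N) (x.1, x.2.1, CloudNetwork.splitCopy x.2.2 (topCopy x.2.2)
      (consume x.1 x.2.1 s) (consume x.1 x.2.1 r)) := by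
  refine ⟨?_, fun k hk => ?_⟩
  · dsimp only
    rw [hx.active_splitCopy hcov]
    exact hx.1
  · simp only [CloudNetwork.splitCopy] at hk ⊢
    by_cases h : x.2.2 k = topCopy x.2.2
    · rw [if_pos h]
      split_ifs with h1
      · exact ⟨h1, (consume_subset _ _ _).trans hs, consume_consume _ _ _⟩
      · exact ⟨(hx.mem_copies hcov h).resolve_left h1, (consume_subset _ _ _).trans hr,
          consume_consume _ _ _⟩
    · rw [if_neg h] at hk ⊢
      exact hx.2 k hk

end Validity

/-! ### Finiteness of the expected numbers of visits -/

section Visits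

variable {V : Type u} {Φ : Type v} [Fintype V] [DecidableEq V] [Fintype Φ] {N : CloudNetwork V Φ}
variable {lam : N.ArrivalVector} {F : N.Interface → N.Chain → Finset V → ℝ}
  {d : V → N.Chain → Finset V → Finset V → Finset V → ℝ}

omit [Fintype Φ] in
theorem hasCopy_nonneg (y : N.Packet) (r : N.Queue) : 0 ≤ hasCopy y r := by
  unfold hasCopy
  split_ifs <;> simp

omit [Fintype Φ] in
theorem top_le_hasCopy {x : N.Packet} (hx : x.IsValid) (r : N.Queue) :
    (if x.top = r then (1 : ℝ) else 0) ≤ hasCopy x r := by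
  split_ifs with h
  · subst h
    obtain ⟨k, hk, hne⟩ := hx.exists_eq_topCopy
    exact (if_pos ⟨hx, rfl, rfl, hne, k, hk⟩).ge
  · exact hasCopy_nonneg x r

omit [Fintype Φ] in
theorem hasCopy_dropCopy_le {x : N.Packet} (hx : x.IsValid) (r : N.Queue) :
    hasCopy (N := N) (x.1, x.2.1, dropCopy x.2.2 (topCopy x.2.2)) r ≤
      hasCopy x r - if x.top = r then 1 else 0 := by
  by_cases h : Packet.IsValid (N := N) (x.1, x.2.1, dropCopy x.2.2 (topCopy x.2.2)) ∧
      x.1 = r.1 ∧ x.2.1 = r.2.1 ∧ r.2.2 ≠ ∅ ∧ ∃ k, dropCopy x.2.2 (topCopy x.2.2) k = r.2.2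
  · have h' := h
    obtain ⟨-, h1, h2, h3, k, hk⟩ := h'
    simp only [dropCopy] at hk
    split_ifs at hk with h4
    · exact absurd hk.symm h3
    · have h5 : x.top ≠ r := fun h5 => h4 (by rw [hk, ← h5]; rfl)
      rw [if_neg h5, sub_zero, hasCopy, if_pos h, hasCopy, if_pos ⟨hx, h1, h2, h3, k, hk⟩]
  · rw [hasCopy, if_neg h]
    exact sub_nonneg.2 (top_le_hasCopy hx r)

omit [Fintype Φ] in
theorem hasCopy_assignAll_le {j : V} {c : N.Chain} {n t : Finset V} (hn : n ⊆ c.dest)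
    (r : N.Queue) : hasCopy (N := N) (j, c, assignAll (consume j c n) t) r ≤
      if j = r.1 ∧ c = r.2.1 then becomes r.1 r.2.1 n r.2.2 else 0 := by
  unfold hasCopy
  split_ifs with h1 h2 h2
  · obtain ⟨-, h3, h4, h5, k, hk⟩ := h1
    dsimp only at h3 h4
    subst h3 h4
    simp only [assignAll] at hk
    split_ifs at hk
    · exact (if_pos ⟨hn, hk, h5⟩).ge
    · exact absurd hk.symm h5
  · exact absurd ⟨h1.2.1, h1.2.2.1⟩ h2
  · exact becomes_nonneg _ _ _ _
  · exact le_rfl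

omit [Fintype Φ] in
theorem hasCopy_splitCopy_le {x : N.Packet} (hx : x.IsValid) {s t : Finset V}
    (hs : s ⊆ x.2.1.dest) (ht : t ⊆ x.2.1.dest) (r : N.Queue) :
    hasCopy (N := N) (x.1, x.2.1, splitCopy x.2.2 (topCopy x.2.2)
      (consume x.1 x.2.1 s) (consume x.1 x.2.1 t)) r ≤
      (hasCopy x r - if x.top = r then 1 else 0) + if x.1 = r.1 ∧ x.2.1 = r.2.1 then
        becomes r.1 r.2.1 s r.2.2 + becomes r.1 r.2.1 t r.2.2 else 0 := by
  have h0 := sub_nonneg.2 (top_le_hasCopy hx r)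
  have h0' : (0 : ℝ) ≤ if x.1 = r.1 ∧ x.2.1 = r.2.1 then
      becomes r.1 r.2.1 s r.2.2 + becomes r.1 r.2.1 t r.2.2 else 0 := by
    split_ifs
    exacts [add_nonneg (becomes_nonneg _ _ _ _) (becomes_nonneg _ _ _ _), le_rfl]
  by_cases h : Packet.IsValid (N := N) (x.1, x.2.1, splitCopy x.2.2 (topCopy x.2.2)
      (consume x.1 x.2.1 s) (consume x.1 x.2.1 t)) ∧ x.1 = r.1 ∧ x.2.1 = r.2.1 ∧ r.2.2 ≠ ∅ ∧
      ∃ k, splitCopy x.2.2 (topCopy x.2.2) (consume x.1 x.2.1 s) (consume x.1 x.2.1 t) k = r.2.2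
  · have h' := h
    obtain ⟨-, h1, h2, h3, k, hk⟩ := h'
    have h6 : (if x.1 = r.1 ∧ x.2.1 = r.2.1 then
        becomes r.1 r.2.1 s r.2.2 + becomes r.1 r.2.1 t r.2.2 else 0) =
        becomes r.1 r.2.1 s r.2.2 + becomes r.1 r.2.1 t r.2.2 := if_pos ⟨h1, h2⟩
    rw [hasCopy, if_pos h, h6]
    simp only [splitCopy] at hk
    split_ifs at hk with h4 h5
    · have : becomes r.1 r.2.1 s r.2.2 = 1 := by
        rw [h1, h2] at hk
        exact if_pos ⟨h2 ▸ hs, hk, h3⟩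
      linarith [becomes_nonneg r.1 r.2.1 t r.2.2]
    · have : becomes r.1 r.2.1 t r.2.2 = 1 := by
        rw [h1, h2] at hk
        exact if_pos ⟨h2 ▸ ht, hk, h3⟩
      linarith [becomes_nonneg r.1 r.2.1 s r.2.2]
    · have h5 : x.top ≠ r := fun h5 => h4 (by rw [hk, ← h5]; rfl)
      have h7 : hasCopy x r = 1 := if_pos ⟨hx, h1, h2, h3, k, hk⟩
      rw [if_neg h5, h7]
      linarith [becomes_nonneg r.1 r.2.1 s r.2.2, becomes_nonneg r.1 r.2.1 t r.2.2]
  · rw [hasCopy, if_neg h]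
    exact add_nonneg h0 h0'

theorem IsNominalFlow.outRate_nonneg (h : IsNominalFlow lam F d) (r : N.Queue) :
    0 ≤ outRate F d r :=
  add_nonneg (netOut_nonneg h.op_nonneg _ _ _) (copiesOut_nonneg (h.dup_nonneg _ _) _)

theorem IsNominalFlow.transfer_nonneg (h : IsNominalFlow lam F d) (r' r : N.Queue) :
    0 ≤ transfer F d r' r := by
  refine add_nonneg (Finset.sum_nonneg fun ι _ => mul_nonneg (h.op_nonneg _ _ _)
    (mul_nonneg (deliver_nonneg _ _ _ _) (becomes_nonneg _ _ _ _)))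
    (Finset.sum_nonneg fun s _ => Finset.sum_nonneg fun t _ => mul_nonneg (h.dup_nonneg _ _ _ _ _)
      ?_)
  split_ifs
  exacts [add_nonneg (becomes_nonneg _ _ _ _) (becomes_nonneg _ _ _ _), le_rfl]

theorem IsNominalFlow.successors_nonneg (h : IsNominalFlow lam F d) (x : N.Packet)
    {φ : N.Packet → ℝ} (hφ : ∀ y, 0 ≤ φ y) : 0 ≤ successors F d x φ := by
  rw [successors_apply]
  exact add_nonneg (Finset.sum_nonneg fun ι _ => mul_nonneg (h.op_nonneg _ _ _)
    (add_nonneg (hφ _) (Finset.sum_nonneg fun j _ => Finset.sum_nonneg fun c' _ =>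
      mul_nonneg (deliver_nonneg _ _ _ _) (hφ _))))
    (Finset.sum_nonneg fun s _ => Finset.sum_nonneg fun t _ =>
      mul_nonneg (h.dup_nonneg _ _ _ _ _) (hφ _))

theorem sum_deliver_hasCopy_le {ι : N.Interface} {c : N.Chain} {n : Finset V} (hn : n ⊆ c.dest)
    (t : V → N.Chain → Finset V) (r : N.Queue) :
    ∑ j, ∑ c', deliver ι c j c' * hasCopy (N := N) (j, c', assignAll (consume j c' n) (t j c')) r ≤
      deliver ι c r.1 r.2.1 * becomes r.1 r.2.1 n r.2.2 := by
  calc _ ≤ ∑ j, ∑ c', deliver ι c j c' *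
        if j = r.1 ∧ c' = r.2.1 then becomes r.1 r.2.1 n r.2.2 else 0 := by
        refine Finset.sum_le_sum fun j _ => Finset.sum_le_sum fun c' _ => ?_
        rcases eq_or_ne (deliver ι c j c') 0 with h0 | h0
        · simp [h0]
        · exact mul_le_mul_of_nonneg_left
            (hasCopy_assignAll_le (dest_eq_of_deliver_ne_zero h0 ▸ hn) r) (deliver_nonneg _ _ _ _)
    _ = _ := by
        rw [Finset.sum_eq_single r.1 _ (by simp), Finset.sum_eq_single r.2.1 _ (by simp)]
        · simp
        · intro c' _ hc
          simp [hc]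
        · intro j _ hj
          simp [hj]

theorem IsNominalFlow.successors_hasCopy_le (h : IsNominalFlow lam F d) {x : N.Packet}
    (hx : x.IsValid) (r : N.Queue) :
    successors F d x (hasCopy · r) ≤
      outRate F d x.top * (hasCopy x r - if x.top = r then 1 else 0) + transfer F d x.top r := by
  set δ := hasCopy x r - if x.top = r then (1 : ℝ) else 0 with hδ
  have h1 : outRate F d x.top * δ + transfer F d x.top r =
      (∑ ι with source ι = x.1, F ι x.2.1 (topCopy x.2.2) * (δ +
        deliver ι x.2.1 r.1 r.2.1 * becomes r.1 r.2.1 (topCopy x.2.2) r.2.2)) +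
      ∑ s, ∑ t, d x.1 x.2.1 (topCopy x.2.2) s t * (δ + if x.1 = r.1 ∧ x.2.1 = r.2.1 then
        becomes r.1 r.2.1 s r.2.2 + becomes r.1 r.2.1 t r.2.2 else 0) := by
    have h2 : outRate F d x.top =
        netOut F x.1 x.2.1 (topCopy x.2.2) + copiesOut (d x.1 x.2.1) (topCopy x.2.2) := rfl
    have h3 : transfer F d x.top r = (∑ ι with source ι = x.1, F ι x.2.1 (topCopy x.2.2) *
          (deliver ι x.2.1 r.1 r.2.1 * becomes r.1 r.2.1 (topCopy x.2.2) r.2.2)) +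
        ∑ s, ∑ t, d x.1 x.2.1 (topCopy x.2.2) s t * if x.1 = r.1 ∧ x.2.1 = r.2.1 then
          becomes r.1 r.2.1 s r.2.2 + becomes r.1 r.2.1 t r.2.2 else 0 := rfl
    rw [h2, h3]
    simp only [mul_add, Finset.sum_add_distrib, netOut_eq, copiesOut, Finset.sum_mul, add_mul]
    ring
  rw [h1, successors_apply]
  refine add_le_add (Finset.sum_le_sum fun ι _ => ?_) (Finset.sum_le_sum fun s _ =>
    Finset.sum_le_sum fun t _ => ?_)
  · exact mul_le_mul_of_nonneg_left (add_le_add (hasCopy_dropCopy_le hx r)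
      (sum_deliver_hasCopy_le hx.topCopy_spec.1 _ r)) (h.op_nonneg _ _ _)
  · rcases eq_or_ne (d x.1 x.2.1 (topCopy x.2.2) s t) 0 with h0 | h0
    · simp [h0]
    · obtain ⟨-, -, -, -, hs, ht, -⟩ := h.dup_coverage _ _ _ _ _ h0
      exact mul_le_mul_of_nonneg_left (hasCopy_splitCopy_le hx hs ht r) (h.dup_nonneg _ _ _ _ _)

theorem sum_transfer (r : N.Queue) :
    ∑ r', transfer F d r' r = ∑ p, becomes r.1 r.2.1 p r.2.2 *
      (netIn F r.1 r.2.1 p + copiesIn (d r.1 r.2.1) p) := by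
  simp only [mul_add, Finset.sum_add_distrib, sum_mul_copiesIn, transfer]
  congr 1
  · simp only [netIn_eq, Finset.mul_sum, Finset.sum_filter]
    rw [Fintype.sum_prod_type, Finset.sum_comm, Fintype.sum_prod_type, Finset.sum_comm]
    refine Finset.sum_congr rfl fun n _ => ?_
    rw [Finset.sum_comm (s := Finset.univ (α := N.Interface))]
    refine Finset.sum_congr rfl fun c _ => ?_
    rw [Finset.sum_comm]
    refine Finset.sum_congr rfl fun ι _ => ?_
    rw [Finset.sum_ite_eq, if_pos (Finset.mem_univ _)]
    ring
  · simp only [Fintype.sum_prod_type]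
    rw [Finset.sum_eq_single r.1 _ (by simp), Finset.sum_eq_single r.2.1 _ (by simp)]
    · simp [mul_add, Finset.sum_add_distrib]
    · intro c _ hc
      simp [hc]
    · intro i _ hi
      simp [hi]

theorem sum_arrivals_mul_hasCopy_le (hlam : ∀ i c q, 0 ≤ lam i c q) (r : N.Queue) :
    ∑ x, arrivals lam x * hasCopy x r ≤
      ∑ p, becomes r.1 r.2.1 p r.2.2 * lam r.1 r.2.1 p := by
  rw [sum_arrivals_mul]
  calc _ ≤ ∑ i, ∑ c, ∑ p, if i = r.1 ∧ c = r.2.1 then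
        becomes r.1 r.2.1 p r.2.2 * lam r.1 r.2.1 p else 0 := by
        refine Finset.sum_le_sum fun i _ => Finset.sum_le_sum fun c _ =>
          Finset.sum_le_sum fun p _ => ?_
        have h0 : 0 ≤ if i = r.1 ∧ c = r.2.1 then
            becomes r.1 r.2.1 p r.2.2 * lam r.1 r.2.1 p else 0 := by
          split_ifs
          exacts [mul_nonneg (becomes_nonneg _ _ _ _) (hlam _ _ _), le_rfl]
        by_cases hp : p ⊆ c.dest
        · rw [if_pos hp]
          split_ifs with h1 h2
          · obtain ⟨rfl, rfl⟩ := h2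
            rw [mul_comm]
            refine mul_le_mul_of_nonneg_right ?_ (hlam _ _ _)
            exact (hasCopy_assignAll_le hp r).trans (if_pos ⟨rfl, rfl⟩).le
          · refine (mul_le_mul_of_nonneg_left ((hasCopy_assignAll_le hp r).trans
              (if_neg h2).le) (hlam _ _ _)).trans (mul_zero _).le
          · rw [mul_zero]; exact mul_nonneg (becomes_nonneg _ _ _ _) (hlam _ _ _)
          · rw [mul_zero]
        · rw [if_neg hp]
          exact h0
    _ = _ := by
        rw [Finset.sum_eq_single r.1 _ (by simp), Finset.sum_eq_single r.2.1 _ (by simp)]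
        · simp
        · intro c _ hc
          simp [hc]
        · intro i _ hi
          simp [hi]

/-- The expected numbers `X` of visits exist, and the packets use no more copies from a queue than
the policy that is emulated. -/
theorem IsNominalFlow.exists_visits (h : IsNominalFlow lam F d)
    (hlam : ∀ i c q, 0 ≤ lam i c q) :
    ∃ X : N.Packet → ℝ, (∀ x, 0 ≤ X x) ∧ (∀ x, ¬ x.IsValid → X x = 0) ∧
      (∀ y, X y = arrivals lam y + ∑ x, X x * kernel F d x y) ∧
      ∀ r, ∑ x with x.top = r, X x ≤ outRate F d r := by
  refine exists_occupation (cnt := hasCopy) (P := fun r' r => transfer F d r' r / outRate F d r')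
    (fun x => ?_) (fun x y => ?_) (fun r r' => div_nonneg (h.transfer_nonneg _ _)
    (h.outRate_nonneg _)) (fun x hx => if_neg hx) (fun x y hy => if_neg hy)
    (fun x r hx => top_le_hasCopy hx r) (fun x r hx => ?_) h.outRate_nonneg (fun r => ?_)
  · unfold arrivals
    split_ifs
    · refine Finset.sum_nonneg fun p _ => ?_
      split_ifs
      exacts [hlam _ _ _, le_rfl]
    · exact le_rfl
  · unfold kernel
    split_ifs
    · exact div_nonneg (h.successors_nonneg x fun z => by split_ifs <;> simp) (h.outRate_nonneg _)
    · exact le_rfl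
  · rw [sum_kernel_mul]
    have h1 : (fun y : N.Packet => if y.IsValid then hasCopy y r else 0) = (hasCopy · r) := by
      funext y
      unfold hasCopy
      split_ifs with h1 h2 h2 <;> first | rfl | exact absurd h2.1 h1
    rw [h1]
    rcases (h.outRate_nonneg x.top).eq_or_lt with h0 | h0
    · rw [← h0, div_zero, div_zero, add_zero, zero_add]
      exact top_le_hasCopy hx r
    · have h2 := div_le_div_of_nonneg_right (h.successors_hasCopy_le hx r) h0.le
      rw [add_div, mul_div_cancel_left₀ _ h0.ne'] at h2
      linarith
  · have h1 : ∑ r', outRate F d r' * (transfer F d r' r / outRate F d r') ≤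
        ∑ r', transfer F d r' r := by
      refine Finset.sum_le_sum fun r' _ => ?_
      rcases eq_or_ne (outRate F d r') 0 with h0 | h0
      · rw [h0, zero_mul]; exact h.transfer_nonneg _ _
      · rw [mul_div_cancel₀ _ h0]
    have h2 := (h.balance r.1 r.2.1).sum_becomes_le (fun q => h.outRate_nonneg (r.1, r.2.1, q))
      r.2.2
    rw [sum_transfer] at h1
    refine (add_le_add (sum_arrivals_mul_hasCopy_le hlam r) h1).trans (le_trans (le_of_eq ?_) h2)
    rw [← Finset.sum_add_distrib]
    exact Finset.sum_congr rfl fun p _ => by ring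

end Visits

/-! ### The efficient flow of the branching process -/

section Emulated

variable {V : Type u} {Φ : Type v} [Fintype V] [DecidableEq V] [Fintype Φ] {N : CloudNetwork V Φ}

/-- The rate at which the interface operates packets of `c` with the assignment `τ`, when `X` are
the expected numbers of visits. -/
noncomputable def visitRate (X : N.Packet → ℝ) (F : N.Interface → N.Chain → Finset V → ℝ)
    (d : V → N.Chain → Finset V → Finset V → Finset V → ℝ) (ι : N.Interface) (c : N.Chain)
    (τ : V → Finset V) : ℝ :=
  X (source ι, c, τ) * (F ι c (topCopy τ) / outRate F d (source ι, c, topCopy τ))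

/-- The flow variables of the emulation: from a packet with the destinations `q` still to be served,
the destinations `s` served by its next copy are operated. -/
noncomputable def emulated (X : N.Packet → ℝ) (F : N.Interface → N.Chain → Finset V → ℝ)
    (d : V → N.Chain → Finset V → Finset V → Finset V → ℝ) : N.FlowVector := fun ι c q s =>
  ∑ τ, if active τ = q ∧ served τ (topCopy τ) = s then visitRate X F d ι c τ else 0

variable {lam : N.ArrivalVector} {F : N.Interface → N.Chain → Finset V → ℝ}
  {d : V → N.Chain → Finset V → Finset V → Finset V → ℝ} {X : N.Packet → ℝ}

omit [Fintype Φ] in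
theorem isValid_of_visitRate_ne_zero (hXV : ∀ x, ¬ x.IsValid → X x = 0) {ι : N.Interface}
    {c : N.Chain} {τ : V → Finset V} (h : visitRate X F d ι c τ ≠ 0) :
    Packet.IsValid (N := N) (source ι, c, τ) := by
  by_contra h'
  exact left_ne_zero_of_mul h (hXV _ h')

omit [Fintype Φ] in
theorem sum_emulated_remaining (hXV : ∀ x, ¬ x.IsValid → X x = 0) (ι : N.Interface)
    (c : N.Chain) (q : Finset V) : ∑ s ∈ q.powerset, emulated X F d ι c q s =
      ∑ τ, visitRate X F d ι c τ * if active τ = q then 1 else 0 := by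
  simp only [emulated]
  rw [Finset.sum_comm]
  refine Finset.sum_congr rfl fun τ _ => ?_
  rcases eq_or_ne (visitRate X F d ι c τ) 0 with h0 | h0
  · simp [h0]
  have hv := isValid_of_visitRate_ne_zero hXV h0
  by_cases h1 : active τ = q
  · have h2 : served τ (topCopy τ) ⊆ q := h1 ▸ hv.served_subset_active
    simp [h1, h2]
  · simp [h1]

omit [Fintype Φ] in
theorem sum_emulated_reloaded (hXV : ∀ x, ¬ x.IsValid → X x = 0) (ι : N.Interface)
    (c : N.Chain) (q : Finset V) :
    ∑ s ∈ (c.dest \ q).powerset, emulated X F d ι c (q ∪ s) s =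
      ∑ τ, visitRate X F d ι c τ * if active τ \ served τ (topCopy τ) = q then 1 else 0 := by
  simp only [emulated]
  rw [Finset.sum_comm]
  refine Finset.sum_congr rfl fun τ _ => ?_
  rcases eq_or_ne (visitRate X F d ι c τ) 0 with h0 | h0
  · simp [h0]
  have hv := isValid_of_visitRate_ne_zero hXV h0
  have hsub : served τ (topCopy τ) ⊆ active τ := hv.served_subset_active
  have hact : active τ ⊆ c.dest := hv.active_subset
  split_ifs with h1
  · rw [Finset.sum_eq_single (served τ (topCopy τ))]
    · rw [mul_one]
      refine if_pos ⟨?_, rfl⟩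
      rw [← h1, Finset.sdiff_union_of_subset hsub]
    · intro s _ hs
      exact if_neg fun h => hs h.2.symm
    · intro h2
      refine absurd (Finset.mem_powerset.2 ?_) h2
      rw [Finset.subset_sdiff]
      refine ⟨hsub.trans hact, ?_⟩
      rw [← h1]
      exact Finset.disjoint_sdiff
  · rw [mul_zero]
    refine Finset.sum_eq_zero fun s hs => if_neg fun h => h1 ?_
    rw [h.1, h.2, Finset.union_sdiff_cancel_right]
    exact Finset.disjoint_sdiff.mono_right (Finset.mem_powerset.1 hs)

omit [Fintype Φ] in
theorem sum_emulated_operated (hXV : ∀ x, ¬ x.IsValid → X x = 0) (ι : N.Interface)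
    (c : N.Chain) (p : Finset V) :
    ∑ s ∈ (c.dest \ p).powerset, emulated X F d ι c (p ∪ s) p =
      ∑ τ, visitRate X F d ι c τ * if served τ (topCopy τ) = p then 1 else 0 := by
  simp only [emulated]
  rw [Finset.sum_comm]
  refine Finset.sum_congr rfl fun τ _ => ?_
  rcases eq_or_ne (visitRate X F d ι c τ) 0 with h0 | h0
  · simp [h0]
  have hv := isValid_of_visitRate_ne_zero hXV h0
  have hsub : served τ (topCopy τ) ⊆ active τ := hv.served_subset_active
  have hact : active τ ⊆ c.dest := hv.active_subset
  split_ifs with h1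
  · subst h1
    rw [Finset.sum_eq_single (active τ \ served τ (topCopy τ))]
    · rw [mul_one]
      refine if_pos ⟨?_, rfl⟩
      rw [Finset.union_sdiff_of_subset hsub]
    · intro s hs hne
      refine if_neg fun h => hne ?_
      rw [h.1, Finset.union_sdiff_cancel_left]
      exact Finset.disjoint_sdiff.mono_right (Finset.mem_powerset.1 hs)
    · intro h2
      exact absurd (Finset.mem_powerset.2 (Finset.sdiff_subset_sdiff hact subset_rfl)) h2
  · rw [mul_zero]
    exact Finset.sum_eq_zero fun s hs => if_neg fun h => h1 h.2

omit [Fintype Φ] in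
theorem sum_sum_emulated (ι : N.Interface) (c : N.Chain) :
    ∑ s, operated (emulated X F d) ι c s = ∑ τ, visitRate X F d ι c τ := by
  simp only [operated, emulated]
  calc _ = ∑ s, ∑ τ, ∑ q, if active τ = q ∧ served τ (topCopy τ) = s then
        visitRate X F d ι c τ else 0 := Finset.sum_congr rfl fun s _ => Finset.sum_comm
    _ = ∑ τ, ∑ s, ∑ q, if active τ = q ∧ served τ (topCopy τ) = s then
        visitRate X F d ι c τ else 0 := Finset.sum_comm
    _ = _ := by
        refine Finset.sum_congr rfl fun τ _ => ?_
        simp [ite_and]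

/-- The emulation uses the interfaces no more than the policy that is emulated. -/
theorem IsNominalFlow.sum_emulated_le (h : IsNominalFlow lam F d)
    (hXle : ∀ r : N.Queue, ∑ x with x.top = r, X x ≤ outRate F d r) (ι : N.Interface)
    (c : N.Chain) : ∑ s, operated (emulated X F d) ι c s ≤ ∑ n, F ι c n := by
  rw [sum_sum_emulated, ← Finset.sum_fiberwise Finset.univ topCopy]
  refine Finset.sum_le_sum fun n _ => ?_
  have h1 : ∑ τ with topCopy τ = n, visitRate X F d ι c τ =
      (∑ τ with topCopy τ = n, X (source ι, c, τ)) *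
        (F ι c n / outRate F d (source ι, c, n)) := by
    rw [Finset.sum_mul]
    refine Finset.sum_congr rfl fun τ hτ => ?_
    rw [visitRate, (Finset.mem_filter.1 hτ).2]
  have h2 : ∑ τ with topCopy τ = n, X (source ι, c, τ) =
      ∑ x with x.top = (source ι, c, n), X x := by
    refine Finset.sum_bij (fun τ _ => (source ι, c, τ)) ?_ ?_ ?_ fun _ _ => rfl
    · intro τ hτ
      simpa [Packet.top] using hτ
    · intro τ _ τ' _ h'
      simpa using h'
    · rintro ⟨i, c', τ⟩ hx
      simp only [Packet.top, Finset.mem_filter, Finset.mem_univ, true_and, Prod.mk.injEq] at hx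
      obtain ⟨rfl, rfl, rfl⟩ := hx
      exact ⟨τ, by simp, rfl⟩
  rw [h1, h2]
  refine (mul_le_mul_of_nonneg_right (hXle _)
    (div_nonneg (h.op_nonneg _ _ _) (h.outRate_nonneg _))).trans ?_
  rcases eq_or_ne (outRate F d (source ι, c, n)) 0 with h0 | h0
  · rw [h0, zero_mul]; exact h.op_nonneg _ _ _
  · rw [mul_div_cancel₀ _ h0]

theorem sum_packet_interface (a : N.Packet → N.Interface → ℝ) :
    ∑ x : N.Packet, ∑ ι with source ι = x.1,
        X x * (F ι x.2.1 (topCopy x.2.2) / outRate F d x.top) * a x ι =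
      ∑ ι, ∑ c, ∑ τ, visitRate X F d ι c τ * a (source ι, c, τ) ι := by
  simp only [Finset.sum_filter]
  rw [Finset.sum_comm]
  refine Finset.sum_congr rfl fun ι _ => ?_
  rw [Fintype.sum_prod_type, Finset.sum_eq_single (source ι), Fintype.sum_prod_type]
  · simp [visitRate, Packet.top]
  · intro i _ hi
    exact Finset.sum_eq_zero fun y _ => if_neg hi.symm
  · simp

/-- Indicator of the packets of `c` at node `i` for which the destinations `q` are still to be
served. -/
noncomputable def atStatus (i : V) (c : N.Chain) (q : Finset V) (x : N.Packet) : ℝ :=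
  if x.1 = i ∧ x.2.1 = c ∧ active x.2.2 = q then 1 else 0

theorem sum_arrivals_mul_atStatus {i : V} {c : N.Chain} {q : Finset V} (hq : q.Nonempty) :
    ∑ x, arrivals lam x * atStatus i c q x = ∑ p, becomes i c p q * lam i c p := by
  rw [sum_arrivals_mul, Finset.sum_eq_single i _ (by simp), Finset.sum_eq_single c _ (by simp)]
  · refine Finset.sum_congr rfl fun p _ => ?_
    have h1 : active (assignAll (consume i c p) (consume i c p)) = consume i c p :=
      active_assignAll_of_subset subset_rfl
    by_cases hp : p ⊆ c.dest
    · rw [if_pos hp, mul_comm]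
      congr 1
      simp only [atStatus, becomes, h1, true_and, hp, hq.ne_empty, ne_eq, not_false_eq_true,
        and_true]
      by_cases h2 : consume i c p = q
      · rw [if_pos h2, if_pos]
        exact isValid_assignAll subset_rfl hp (h2 ▸ hq)
      · rw [if_neg h2, ite_self]
    · rw [if_neg hp, becomes, if_neg fun h => hp h.1, zero_mul]
  · intro c' _ hc
    simp [atStatus, hc]
  · intro j _ hj
    simp [atStatus, hj]

/-- The packets at a status after one step. -/
theorem IsNominalFlow.successors_atStatus (h : IsNominalFlow lam F d) {i : V} {c : N.Chain}
    {q : Finset V} (hq : q.Nonempty) {x : N.Packet} (hx : x.IsValid) :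
    successors F d x (fun y => if y.IsValid then atStatus i c q y else 0) =
      (∑ ι with source ι = x.1, F ι x.2.1 (topCopy x.2.2) *
        ((if x.1 = i ∧ x.2.1 = c ∧ active x.2.2 \ served x.2.2 (topCopy x.2.2) = q then 1 else 0) +
          deliver ι x.2.1 i c *
            if consume i c (served x.2.2 (topCopy x.2.2)) = q then 1 else 0)) +
      copiesOut (d x.1 x.2.1) (topCopy x.2.2) * atStatus i c q x := by
  rw [successors_apply, copiesOut, Finset.sum_mul]
  congr 1
  · refine Finset.sum_congr rfl fun ι _ => ?_
    congr 2
    · simp only [atStatus, active_dropCopy]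
      by_cases h1 : x.1 = i ∧ x.2.1 = c ∧ active x.2.2 \ served x.2.2 (topCopy x.2.2) = q
      · rw [if_pos h1, if_pos]
        refine hx.dropCopy ?_
        rw [active_dropCopy, h1.2.2]
        exact hq
      · rw [if_neg h1, ite_self]
    · have hsub := hx.served_subset
      have h1 : ∀ (j : V) (c' : N.Chain), active (assignAll (consume j c' (topCopy x.2.2))
          (consume j c' (served x.2.2 (topCopy x.2.2)))) =
          consume j c' (served x.2.2 (topCopy x.2.2)) := fun j c' =>
        active_assignAll_of_subset (consume_mono j c' hsub)
      rw [Finset.sum_eq_single i _ (by simp), Finset.sum_eq_single c _ (by simp)]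
      · rcases eq_or_ne (deliver ι x.2.1 i c) 0 with h0 | h0
        · rw [h0, zero_mul, zero_mul]
        · congr 1
          simp only [atStatus, h1, true_and]
          by_cases h2 : consume i c (served x.2.2 (topCopy x.2.2)) = q
          · rw [if_pos h2, if_pos]
            refine isValid_assignAll hsub ?_ (h2 ▸ hq)
            rw [← dest_eq_of_deliver_ne_zero h0]
            exact hx.topCopy_spec.1
          · rw [if_neg h2, ite_self]
      · intro c' _ hc
        simp [atStatus, hc]
      · intro j _ hj
        simp [atStatus, hj]
  · refine Finset.sum_congr rfl fun s _ => ?_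
    rw [Finset.sum_mul]
    refine Finset.sum_congr rfl fun r _ => ?_
    rcases eq_or_ne (d x.1 x.2.1 (topCopy x.2.2) s r) 0 with h0 | h0
    · rw [h0, zero_mul, zero_mul]
    · obtain ⟨-, -, -, -, hs, hr, hcov⟩ := h.dup_coverage _ _ _ _ _ h0
      rw [if_pos (hx.splitCopy hs hr hcov)]
      simp only [atStatus, hx.active_splitCopy hcov]

theorem sum_interface_chain {i : V} {c : N.Chain}
    {g a : N.Interface → N.Chain → (V → Finset V) → ℝ} {b : (V → Finset V) → ℝ}
    (ha : ∀ ι c' τ, a ι c' τ = if source ι = i ∧ c' = c then b τ else 0) :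
    ∑ ι, ∑ c', ∑ τ, g ι c' τ * a ι c' τ = ∑ ι with source ι = i, ∑ τ, g ι c τ * b τ := by
  rw [Finset.sum_filter]
  refine Finset.sum_congr rfl fun ι _ => ?_
  simp only [ha]
  split_ifs with h
  · rw [Finset.sum_eq_single c _ (by simp)]
    · simp [h]
    · intro c' _ hc
      simp [hc]
  · simp [h]

theorem sum_visitRate_atStatus (hXV : ∀ x, ¬ x.IsValid → X x = 0) (i : V) (c : N.Chain)
    (q : Finset V) :
    ∑ ι, ∑ c', ∑ τ, visitRate X F d ι c' τ * atStatus i c q (source ι, c', τ) =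
    rateOut (emulated X F d) i c q := by
  rw [rateOut_eq, Finset.sum_comm (s := q.powerset)]
  simp only [sum_emulated_remaining hXV]
  refine sum_interface_chain fun ι c' τ => ?_
  simp only [atStatus, ← and_assoc]
  rw [ite_and]

theorem sum_visitRate_reloaded (hXV : ∀ x, ¬ x.IsValid → X x = 0) (i : V) (c : N.Chain)
    (q : Finset V) :
    ∑ ι, ∑ c', ∑ τ, visitRate X F d ι c' τ *
        (if source ι = i ∧ c' = c ∧ active τ \ served τ (topCopy τ) = q then 1 else 0) =
    ∑ s ∈ (c.dest \ q).powerset, ∑ ι with source ι = i, emulated X F d ι c (q ∪ s) s := by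
  rw [Finset.sum_comm (s := (c.dest \ q).powerset)]
  simp only [sum_emulated_reloaded hXV]
  refine sum_interface_chain fun ι c' τ => ?_
  simp only [← and_assoc]
  rw [ite_and]

theorem sum_visitRate_sent (hXV : ∀ x, ¬ x.IsValid → X x = 0) (i : V) (c : N.Chain)
    {q : Finset V} (hq : q.Nonempty) :
    ∑ ι, ∑ c', ∑ τ, visitRate X F d ι c' τ *
    (deliver ι c' i c *
        if consume i c (served τ (topCopy τ)) = q then 1 else 0) = ∑ p, becomes i c p q *
      ∑ s ∈ (c.dest \ p).powerset, ∑ ι, ∑ c', deliver ι c' i c *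
        emulated X F d ι c' (p ∪ s) p := by
  have h1 : ∀ p, ∑ s ∈ (c.dest \ p).powerset, ∑ ι, ∑ c', deliver ι c' i c *
      emulated X F d ι c' (p ∪ s) p = ∑ ι, ∑ c', deliver ι c' i c *
        ∑ τ, visitRate X F d ι c' τ * if served τ (topCopy τ) = p then 1 else 0 := by
    intro p
    rw [Finset.sum_comm]
    refine Finset.sum_congr rfl fun ι _ => ?_
    rw [Finset.sum_comm]
    refine Finset.sum_congr rfl fun c' _ => ?_
    rw [← Finset.mul_sum]
    rcases eq_or_ne (deliver ι c' i c) 0 with h0 | h0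
    · rw [h0, zero_mul, zero_mul]
    · rw [← dest_eq_of_deliver_ne_zero h0, sum_emulated_operated hXV]
  simp only [h1, Finset.mul_sum]
  symm
  rw [Finset.sum_comm]
  refine Finset.sum_congr rfl fun ι _ => ?_
  rw [Finset.sum_comm]
  refine Finset.sum_congr rfl fun c' _ => ?_
  rw [Finset.sum_comm]
  refine Finset.sum_congr rfl fun τ _ => ?_
  rcases eq_or_ne (visitRate X F d ι c' τ) 0 with h0 | h0
  · simp [h0]
  rcases eq_or_ne (deliver ι c' i c) 0 with h2 | h2
  · simp [h2]
  have hv := isValid_of_visitRate_ne_zero hXV h0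
  have hsub : served τ (topCopy τ) ⊆ c.dest := by
    rw [← dest_eq_of_deliver_ne_zero h2]
    exact hv.served_subset_active.trans hv.active_subset
  rw [Finset.sum_eq_single (served τ (topCopy τ)) _ (by simp)]
  · simp only [becomes, hsub, hq.ne_empty, ne_eq, not_false_eq_true, and_true, true_and,
      if_true]
    split_ifs <;> simp [mul_comm]
  · intro p _ hp
    simp [hp.symm]

/-- The flow variables of the emulation balance the rates of packets by their remaining
destinations. -/
theorem IsNominalFlow.emulated_balance (h : IsNominalFlow lam F d) (hX0 : ∀ x, 0 ≤ X x)
    (hXV : ∀ x, ¬ x.IsValid → X x = 0)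
    (hX : ∀ y, X y = arrivals lam y + ∑ x, X x * kernel F d x y)
    (hXle : ∀ r : N.Queue, ∑ x with x.top = r, X x ≤ outRate F d r)
    (i : V) (c : N.Chain) {q : Finset V} (hq : q.Nonempty) :
    ∑ p, becomes i c p q * (∑ s ∈ (c.dest \ p).powerset,
        ∑ ι, ∑ c', deliver ι c' i c * emulated X F d ι c' (p ∪ s) p + lam i c p) +
      ∑ s ∈ (c.dest \ q).powerset, ∑ ι with source ι = i, emulated X F d ι c (q ∪ s) s =
    rateOut (emulated X F d) i c q := by
  let reload : N.Packet → ℝ := fun x =>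
    if x.1 = i ∧ x.2.1 = c ∧ active x.2.2 \ served x.2.2 (topCopy x.2.2) = q then 1 else 0
  let sent : N.Packet → ℝ := fun x => if consume i c (served x.2.2 (topCopy x.2.2)) = q then 1 else 0
  have hstep : ∑ x, X x * atStatus i c q x = ∑ p, becomes i c p q * lam i c p +
      ∑ x, X x * (successors F d x (fun y => if y.IsValid then atStatus i c q y else 0) /
        outRate F d x.top) := by
    rw [← sum_arrivals_mul_atStatus hq]
    conv_lhs => enter [2, y]; rw [hX y, add_mul, Finset.sum_mul]
    rw [Finset.sum_add_distrib, Finset.sum_comm]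
    congr 1
    refine Finset.sum_congr rfl fun x _ => ?_
    simp only [mul_assoc, ← Finset.mul_sum, sum_kernel_mul]
  -- what duplication does to a packet cancels, as the destinations that remain are the same
  have hx : ∀ x : N.Packet, X x * atStatus i c q x -
      X x * (successors F d x (fun y => if y.IsValid then atStatus i c q y else 0) /
        outRate F d x.top) =
      ∑ ι with source ι = x.1, X x * (F ι x.2.1 (topCopy x.2.2) / outRate F d x.top) *
        (atStatus i c q x - reload x - deliver ι x.2.1 i c * sent x) := by
    intro x
    rcases eq_or_ne (X x) 0 with h0 | h0
    · simp [h0]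
    have hv : x.IsValid := by
      by_contra h'
      exact h0 (hXV x h')
    have hout : outRate F d x.top ≠ 0 := by
      intro h1
      have h2 := hXle x.top
      rw [h1] at h2
      have h3 := Finset.single_le_sum (f := X) (s := Finset.univ.filter (·.top = x.top))
        (fun y _ => hX0 y) (Finset.mem_filter.2 ⟨Finset.mem_univ x, rfl⟩)
      exact h0 (le_antisymm (h3.trans h2) (hX0 x))
    rw [h.successors_atStatus hq hv]
    have h1 : ∀ ι, X x * (F ι x.2.1 (topCopy x.2.2) / outRate F d x.top) *
        (atStatus i c q x - reload x - deliver ι x.2.1 i c * sent x) =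
        X x / outRate F d x.top * (F ι x.2.1 (topCopy x.2.2) * atStatus i c q x -
          F ι x.2.1 (topCopy x.2.2) * (reload x + deliver ι x.2.1 i c * sent x)) := by
      intro ι
      ring
    simp only [h1]
    rw [← Finset.mul_sum, Finset.sum_sub_distrib, ← Finset.sum_mul]
    have h2 : ∑ ι with source ι = x.1, F ι x.2.1 (topCopy x.2.2) =
        outRate F d x.top - copiesOut (d x.1 x.2.1) (topCopy x.2.2) := by
      rw [← netOut_eq]
      exact (add_sub_cancel_right _ _).symm
    rw [h2]
    have h3 : ∀ a s k o y : ℝ, o ≠ 0 → y * a - y * ((s + k * a) / o) =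
        y / o * ((o - k) * a - s) := by
      intro a s k o y ho
      field_simp
      ring
    exact h3 _ _ _ _ _ hout
  have hsum : ∑ p, becomes i c p q * lam i c p = ∑ ι, ∑ c', ∑ τ, visitRate X F d ι c' τ *
      (atStatus i c q (source ι, c', τ) - reload (source ι, c', τ) -
        deliver ι c' i c * sent (source ι, c', τ)) := by
    rw [← sum_packet_interface (X := X) (F := F) (d := d) fun x ι =>
      atStatus i c q x - reload x - deliver ι x.2.1 i c * sent x]
    simp only [← hx]
    rw [Finset.sum_sub_distrib, hstep]
    ring
  simp only [mul_sub, Finset.sum_sub_distrib] at hsum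
  have hout := sum_visitRate_atStatus (F := F) (d := d) hXV i c q
  have hreload := sum_visitRate_reloaded (F := F) (d := d) hXV i c q
  have hsent := sum_visitRate_sent (F := F) (d := d) hXV i c hq
  simp only [reload, sent] at hsum
  rw [hout, hreload, hsent] at hsum
  simp only [mul_add, Finset.sum_add_distrib]
  rw [hsum]
  ring

/-- Every admissible policy can be emulated by an efficient flow that costs no more. -/
theorem IsNominalFlow.exists_isEfficientFlow (h : IsNominalFlow lam F d)
    (hlam : ∀ i c q, 0 ≤ lam i c q) :
    ∃ f, IsEfficientFlow lam f ∧ cost (operated f) ≤ cost F := by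
  obtain ⟨X, hX0, hXV, hX, hXle⟩ := h.exists_visits hlam
  have hsupp : ∀ ι c q s, emulated X F d ι c q s ≠ 0 → ∃ τ, active τ = q ∧
      served τ (topCopy τ) = s ∧ visitRate X F d ι c τ ≠ 0 := by
    intro ι c q s hne
    obtain ⟨τ, -, hτ⟩ := Finset.exists_ne_zero_of_sum_ne_zero hne
    split_ifs at hτ with h1
    exacts [⟨τ, h1.1, h1.2, hτ⟩, absurd rfl hτ]
  have husage : ∀ ι, usage (operated (emulated X F d)) ι ≤ usage F ι := by
    intro ι
    rw [usage_eq, usage_eq]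
    exact Finset.sum_le_sum fun c _ => mul_le_mul_of_nonneg_left
      (h.sum_emulated_le hXle ι c) (resource_nonneg ι c)
  have hcons : ∀ ι (c : N.Chain) q s, c.IsFinal → source ι ∈ q → emulated X F d ι c q s = 0 := by
    intro ι c q s hc hι
    by_contra hne
    obtain ⟨τ, rfl, -, hτ⟩ := hsupp _ _ _ _ hne
    exact (isValid_of_visitRate_ne_zero hXV hτ).notMem_active hc hι
  refine ⟨emulated X F d, ⟨fun ι c q s => ?_, fun ι c q s hne => ?_, fun i c q hq hqD => ?_,
    hcons, fun ι => (husage ι).trans (h.usage_le ι)⟩, ?_⟩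
  · refine Finset.sum_nonneg fun τ _ => ?_
    split_ifs
    exacts [mul_nonneg (hX0 _) (div_nonneg (h.op_nonneg _ _ _) (h.outRate_nonneg _)), le_rfl]
  · obtain ⟨τ, rfl, rfl, hτ⟩ := hsupp _ _ _ _ hne
    have hv := isValid_of_visitRate_ne_zero hXV hτ
    have hF : F ι c (topCopy τ) ≠ 0 := fun h0 => hτ (by rw [visitRate, h0, zero_div, mul_zero])
    exact ⟨(h.op_support _ _ _ hF).1, hv.served_nonempty, hv.served_subset_active,
      hv.active_subset⟩
  · have key : consume i c q = q → (rateIn (emulated X F d) i c q + lam i c q) +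
        (if c.IsFinal ∧ i ∈ c.dest then
          rateIn (emulated X F d) i c (insert i q) + lam i c (insert i q) else 0) ≤
        rateOut (emulated X F d) i c q := by
      intro hqc
      rw [← h.emulated_balance hX0 hXV hX hXle i c hq, sum_becomes hq hqD hqc, rateIn_eq]
      split_ifs with hc
      · have h0 : ∑ s ∈ (c.dest \ insert i q).powerset, ∑ ι with source ι = i,
            emulated X F d ι c (insert i q ∪ s) s = 0 := by
          refine Finset.sum_eq_zero fun s _ => Finset.sum_eq_zero fun ι hι => ?_
          refine hcons _ _ _ _ hc.1 ?_
          rw [(Finset.mem_filter.1 hι).2]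
          exact Finset.mem_union_left _ (Finset.mem_insert_self i q)
        rw [rateIn_eq, h0]
        linarith
      · linarith
    refine ⟨fun hc => ?_, fun hc hi => ?_⟩
    · have hqc : consume i c q = q := by
        ext k
        rw [mem_consume]
        refine ⟨fun hk => hk.1, fun hk => ⟨hk, fun h' => hc ⟨h'.1, ?_⟩⟩⟩
        rw [← h'.2]
        exact hqD hk
      have := key hqc
      rwa [if_neg hc, add_zero] at this
    · have hqc : consume i c q = q := by
        ext k
        rw [mem_consume]
        refine ⟨fun hk => hk.1, fun hk => ⟨hk, fun h' => hi ?_⟩⟩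
        rw [← h'.2]
        exact hk
      have := key hqc
      rwa [if_pos hc] at this
  · rw [cost_eq, cost_eq]
    exact Finset.sum_le_sum fun ι _ => mul_le_mul_of_nonneg_left (husage ι) (price_nonneg ι)

end Emulated

/-! ### Efficient flows of least cost -/

section Optimum

variable {V : Type u} {Φ : Type v} [Fintype V] [DecidableEq V] [Fintype Φ] {N : CloudNetwork V Φ}
variable {lam : N.ArrivalVector}

theorem continuous_rateIn (i : V) (c : N.Chain) (q : Finset V) :
    Continuous fun f : N.FlowVector => rateIn f i c q := by
  simp only [rateIn_eq]
  fun_prop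

omit [Fintype Φ] in
theorem continuous_rateOut (i : V) (c : N.Chain) (q : Finset V) :
    Continuous fun f : N.FlowVector => rateOut f i c q := by
  simp only [rateOut_eq]
  fun_prop

omit [DecidableEq V] [Fintype Φ] in
theorem continuous_operated :
    Continuous fun f : N.FlowVector => operated f := by
  unfold operated
  fun_prop

theorem isClosed_setOf_isEfficientFlow (lam : N.ArrivalVector) :
    IsClosed {f | IsEfficientFlow lam f} := by
  have : {f | IsEfficientFlow lam f} =
      {f : N.FlowVector | ∀ ι c q s, 0 ≤ f ι c q s} ∩
      {f | ∀ ι c q s, ¬ Selectable ι c q s → f ι c q s = 0} ∩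
      {f | ∀ i (c : N.Chain) (q : Finset V), q.Nonempty → q ⊆ c.dest →
        ¬ (c.IsFinal ∧ i ∈ c.dest) → rateIn f i c q + lam i c q ≤ rateOut f i c q} ∩
      {f | ∀ i (c : N.Chain) (q : Finset V), q.Nonempty → q ⊆ c.dest →
        c.IsFinal ∧ i ∈ c.dest → i ∉ q → rateIn f i c q + lam i c q +
          (rateIn f i c (insert i q) + lam i c (insert i q)) ≤ rateOut f i c q} ∩
      {f | ∀ ι (c : N.Chain) q s, c.IsFinal → source ι ∈ q → f ι c q s = 0} ∩
      {f | ∀ ι, usage (operated f) ι ≤ capacity ι} := by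
    ext f
    constructor
    · intro h
      exact ⟨⟨⟨⟨⟨h.nonneg, fun ι c q s hs => not_ne_iff.1 (mt (h.support ι c q s) hs)⟩,
        fun i c q hq hqD => (h.conservation i c q hq hqD).1⟩,
        fun i c q hq hqD => (h.conservation i c q hq hqD).2⟩, h.consumed⟩, h.usage_le⟩
    · rintro ⟨⟨⟨⟨⟨h1, h2⟩, h3⟩, h4⟩, h5⟩, h6⟩
      exact ⟨h1, fun ι c q s => not_imp_comm.1 (h2 ι c q s),
        fun i c q hq hqD => ⟨h3 i c q hq hqD, h4 i c q hq hqD⟩, h5, h6⟩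
  rw [this]
  have hin := fun i (c : N.Chain) q => continuous_rateIn (N := N) i c q
  have hout := fun i (c : N.Chain) q => continuous_rateOut (N := N) i c q
  refine (((((IsClosed.inter ?_ ?_).inter ?_).inter ?_).inter ?_).inter ?_) <;>
  simp only [Set.ofPred_forall]
  · exact isClosed_iInter fun ι => isClosed_iInter fun c => isClosed_iInter fun q =>
      isClosed_iInter fun s => isClosed_le (by fun_prop) (by fun_prop)
  · exact isClosed_iInter fun ι => isClosed_iInter fun c => isClosed_iInter fun q =>
      isClosed_iInter fun s => isClosed_iInter fun _ => isClosed_eq (by fun_prop) (by fun_prop)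
  · exact isClosed_iInter fun i => isClosed_iInter fun c => isClosed_iInter fun q =>
      isClosed_iInter fun _ => isClosed_iInter fun _ => isClosed_iInter fun _ =>
      isClosed_le (by fun_prop) (by fun_prop)
  · exact isClosed_iInter fun i => isClosed_iInter fun c => isClosed_iInter fun q =>
      isClosed_iInter fun _ => isClosed_iInter fun _ => isClosed_iInter fun _ =>
      isClosed_iInter fun _ => isClosed_le (by fun_prop) (by fun_prop)
  · exact isClosed_iInter fun ι => isClosed_iInter fun c => isClosed_iInter fun q =>
      isClosed_iInter fun s => isClosed_iInter fun _ => isClosed_iInter fun _ =>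
      isClosed_eq (by fun_prop) (by fun_prop)
  · exact isClosed_iInter fun ι =>
      isClosed_le ((continuous_usage ι).comp continuous_operated) continuous_const

theorem IsEfficientFlow.le_fullAmount {f : N.FlowVector} (h : IsEfficientFlow lam f)
    (ι : N.Interface) (c : N.Chain) (q s : Finset V) : f ι c q s ≤ fullAmount ι c := by
  rcases eq_or_ne (f ι c q s) 0 with h0 | h0
  · rw [h0]; exact fullAmount_nonneg ι c
  · have hr := resource_pos (h.support _ _ _ _ h0).1
    rw [fullAmount_eq, le_div_iff₀ hr]
    refine le_trans ?_ (h.usage_le ι)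
    rw [usage_operated]
    exact Finset.single_le_sum (f := fun a : N.Chain × Finset V × Finset V =>
      f ι a.1 a.2.1 a.2.2 * resource ι a.1)
      (fun a _ => mul_nonneg (h.nonneg _ _ _ _) (resource_nonneg _ _))
      (Finset.mem_univ (c, q, s))

theorem exists_isMinOn_cost (hne : ∃ f, IsEfficientFlow lam f) :
    ∃ f, IsEfficientFlow lam f ∧
      ∀ g, IsEfficientFlow lam g → cost (operated f) ≤ cost (operated g) := by
  have hcomp : IsCompact {f | IsEfficientFlow lam f} := by
    refine (isCompact_Icc (a := (0 : N.FlowVector)) (b := fun ι c _ _ => fullAmount ι c)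
      ).of_isClosed_subset (isClosed_setOf_isEfficientFlow lam) fun f hf => ?_
    exact ⟨hf.nonneg, hf.le_fullAmount⟩
  obtain ⟨f, hf, hmin⟩ := hcomp.exists_isMinOn hne
    (continuous_cost.comp continuous_operated).continuousOn
  exact ⟨f, hf, fun g hg => hmin hg⟩

theorem IsEfficientFlow.mem_capacityRegion {f : N.FlowVector} (h : IsEfficientFlow lam f) :
    lam ∈ N.capacityRegion :=
  ⟨h.selection.stationaryPolicy, h.isAdmissible⟩

theorem optimalCost_eq (hlam : ∀ i c q, 0 ≤ lam i c q) {f : N.FlowVector}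
    (hf : IsEfficientFlow lam f)
    (hmin : ∀ g, IsEfficientFlow lam g → cost (operated f) ≤ cost (operated g)) :
    N.optimalCost lam = cost (operated f) := by
  refine IsLeast.csInf_eq ⟨⟨_, hf.isAdmissible, hf.hasAvgCost⟩, ?_⟩
  rintro κ ⟨π, hπ, hκ⟩
  obtain ⟨F, d, hF, hcost⟩ := hπ.exists_isNominalFlow
  obtain ⟨g, hg, hle⟩ := hF.exists_isEfficientFlow hlam
  exact (hmin g hg).trans (hle.trans (hcost κ hκ).le)

end Optimum

end CloudNetwork

theorem theorem1 {V : Type u} {Φ : Type v} [Fintype V] [DecidableEq V] [Fintype Φ]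
    (N : CloudNetwork V Φ) (lam : N.ArrivalVector) (hlam : ∀ i c q, 0 ≤ lam i c q) :
    (lam ∈ N.capacityRegion ↔
      ∃ (f : N.FlowVector) (β : N.SelectionProb), CloudNetwork.IsFeasible lam f β) ∧
    (lam ∈ N.capacityRegion →
      ∃ (f : N.FlowVector) (β : N.SelectionProb), CloudNetwork.IsFeasible lam f β ∧
        β.stationaryPolicy.IsAdmissible lam ∧
        β.stationaryPolicy.HasAvgCost (N.optimalCost lam)) := by
  have hflow : lam ∈ N.capacityRegion → ∃ f, CloudNetwork.IsEfficientFlow lam f := by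
    rintro ⟨π, hπ⟩
    obtain ⟨F, d, hF, -⟩ := hπ.exists_isNominalFlow
    obtain ⟨f, hf, -⟩ := hF.exists_isEfficientFlow hlam
    exact ⟨f, hf⟩
  refine ⟨⟨fun h => ?_, ?_⟩, fun h => ?_⟩
  · obtain ⟨f, hf⟩ := hflow h
    exact ⟨f, hf.selection, hf.isFeasible⟩
  · rintro ⟨f, β, hf⟩
    obtain ⟨g, hg⟩ := hf.exists_isEfficientFlow
    exact hg.mem_capacityRegion
  · obtain ⟨f, hf, hmin⟩ := CloudNetwork.exists_isMinOn_cost (hflow h)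
    refine ⟨f, hf.selection, hf.isFeasible, hf.isAdmissible, ?_⟩
    rw [CloudNetwork.optimalCost_eq hlam hf hmin]
    exact hf.hasAvgCost
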